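/- Let $p>1$ be an odd integer and $c_0:=\frac{2(p+1)}{(p-1)^2}$. Let $\mathcal H:=L^2(0,1)^2$ (complex-valued functions). Let $\tilde L_0$ be the operator in $\mathcal H$ with domain $\mathcal D(\tilde L_0):=\{\mathbf u=(u_1,u_2)^T\in C^1[0,1]^2: u_1(0)=0\}$ given by $\tilde L_0\mathbf u:=(-\rho u_1'+u_2',\,u_1'-\rho u_2')^T$; it is closable, and $L_0$ denotes its closure. Let $L'\in\mathcal B(\mathcal H)$ be given by $L'\mathbf u(\rho):=\left(pc_0\int_0^\rho u_2(\xi)\,d\xi,\ 0\right)^T$, and let $L:=L_0+L'$ with $\mathcal D(L)=\mathcal D(L_0)$. For a closed operator $T$ in $\mathcal H$, $\sigma_p(T)$ denotes the set of eigenvalues of $T$ and $\sigma(T)$ the set of those $\lambda\in\mathbb C$ for which $\lambda-T:\mathcal D(T)\to\mathcal H$ does not have a bounded inverse defined on all of $\mathcal H$. Then $$\sigma_p(L)=\sigma_p(L_0)\cup\left\{1+\tfrac{2}{p-1}\right\}\qquad\text{and}\qquad \sigma(L)\supseteq\sigma(L_0).$$ Moreover, $1+\frac{2}{p-1}$ is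 the only eigenvalue $\lambda$ of $L$ with $\mathrm{Re}\,\lambda>\frac12$. -/

import Mathlib

open MeasureTheory Set
open scoped ContDiff

noncomputable section

/-! ## Spectral notions for unbounded operators -/

/-- The point spectrum of an unbounded operator: the set of its eigenvalues. -/
def pointSpectrum {E : Type*} [NormedAddCommGroup E] [NormedSpace ℂ E] (T : E →ₗ.[ℂ] E) : Set ℂ :=
  {z | ∃ u : T.domain, u ≠ 0 ∧ T u = z • (u : E)}

/-- The resolvent set of an unbounded operator: all `z` such that `z - T`, mapping the domain of `T`
to the whole space, has an everywhere defined bounded two-sided inverse `R`. -/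
def opResolventSet {E : Type*} [NormedAddCommGroup E] [NormedSpace ℂ E] (T : E →ₗ.[ℂ] E) : Set ℂ :=
  {z | ∃ R : E →L[ℂ] E,
    (∀ f : E, ∃ u : T.domain, (u : E) = R f ∧ z • (u : E) - T u = f) ∧
    (∀ u : T.domain, R (z • (u : E) - T u) = u)}

/-- The spectrum of an unbounded operator: the complement of the resolvent set. -/
def opSpectrum {E : Type*} [NormedAddCommGroup E] [NormedSpace ℂ E] (T : E →ₗ.[ℂ] E) : Set ℂ :=
  (opResolventSet T)ᶜ

/-! ## The Hilbert space `L²(0,1)²` -/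

/-- Lebesgue measure on the interval `(0,1)`. -/
abbrev unitMeasure : Measure ℝ := volume.restrict (Ioo (0 : ℝ) 1)

/-- The complex Hilbert space `L²(0,1)`. -/
abbrev L2Unit : Type := Lp ℂ 2 unitMeasure

/-- The complex Hilbert space `L²(0,1)²`, with norm `(‖u₁‖² + ‖u₂‖²)^(1/2)`. -/
abbrev StateSpace : Type := WithLp 2 (L2Unit × L2Unit)

/-! ## The free operator -/

/-- The derivative on the closed interval `[0,1]` (one-sided at the end points). -/
abbrev derivUnit (u : ℝ → ℂ) (x : ℝ) : ℂ := derivWithin u (Icc (0 : ℝ) 1) x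

/-- The graph of the operator with domain `{u ∈ C¹[0,1]² : u₁(0) = 0}` and action
`(u₁, u₂) ↦ (-ρ u₁' + u₂', u₁' - ρ u₂')`, as a subspace of `L²(0,1)² × L²(0,1)²`. -/
def classicalGraph : Submodule ℂ (StateSpace × StateSpace) where
  carrier := {x | ∃ u₁ u₂ : ℝ → ℂ,
    ContDiffOn ℝ 1 u₁ (Icc 0 1) ∧ ContDiffOn ℝ 1 u₂ (Icc 0 1) ∧ u₁ 0 = 0 ∧
    x.1.fst =ᵐ[unitMeasure] u₁ ∧ x.1.snd =ᵐ[unitMeasure] u₂ ∧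
    x.2.fst =ᵐ[unitMeasure] (fun ρ => -(ρ : ℂ) * derivUnit u₁ ρ + derivUnit u₂ ρ) ∧
    x.2.snd =ᵐ[unitMeasure] (fun ρ => derivUnit u₁ ρ - (ρ : ℂ) * derivUnit u₂ ρ)}
  zero_mem' := by
    refine ⟨fun _ => 0, fun _ => 0, contDiffOn_const, contDiffOn_const, rfl, ?_, ?_, ?_, ?_⟩
    · exact Lp.coeFn_zero ..
    · exact Lp.coeFn_zero ..
    · refine (Lp.coeFn_zero ..).trans (Filter.Eventually.of_forall fun ρ => ?_)
      simp [derivUnit]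
    · refine (Lp.coeFn_zero ..).trans (Filter.Eventually.of_forall fun ρ => ?_)
      simp [derivUnit]
  add_mem' := by
    rintro x y ⟨u₁, u₂, h₁, h₂, h0, hx1, hx2, hx3, hx4⟩ ⟨v₁, v₂, k₁, k₂, k0, hy1, hy2, hy3, hy4⟩
    have hI : ∀ᵐ ρ ∂unitMeasure, ρ ∈ Ioo (0 : ℝ) 1 := ae_restrict_mem measurableSet_Ioo
    have hd : ∀ {u v : ℝ → ℂ}, ContDiffOn ℝ 1 u (Icc 0 1) → ContDiffOn ℝ 1 v (Icc 0 1) →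
        ∀ ρ ∈ Ioo (0 : ℝ) 1, derivUnit (u + v) ρ = derivUnit u ρ + derivUnit v ρ := by
      intro u v hu hv ρ hρ
      exact derivWithin_add (hu.differentiableOn one_ne_zero ρ (Ioo_subset_Icc_self hρ))
        (hv.differentiableOn one_ne_zero ρ (Ioo_subset_Icc_self hρ))
    refine ⟨u₁ + v₁, u₂ + v₂, h₁.add k₁, h₂.add k₂, by simp [h0, k0], ?_, ?_, ?_, ?_⟩
    · exact (Lp.coeFn_add _ _).trans (hx1.add hy1)
    · exact (Lp.coeFn_add _ _).trans (hx2.add hy2)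
    · refine (Lp.coeFn_add _ _).trans ((hx3.add hy3).trans ?_)
      filter_upwards [hI] with ρ hρ
      rw [hd h₁ k₁ ρ hρ, hd h₂ k₂ ρ hρ]
      simp only [Pi.add_apply]
      ring
    · refine (Lp.coeFn_add _ _).trans ((hx4.add hy4).trans ?_)
      filter_upwards [hI] with ρ hρ
      rw [hd h₁ k₁ ρ hρ, hd h₂ k₂ ρ hρ]
      simp only [Pi.add_apply]
      ring
  smul_mem' := by
    rintro c x ⟨u₁, u₂, h₁, h₂, h0, hx1, hx2, hx3, hx4⟩
    have hd : ∀ (u : ℝ → ℂ) (ρ : ℝ), derivUnit (c • u) ρ = c * derivUnit u ρ := by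
      intro u ρ
      exact derivWithin_const_smul_field c u
    refine ⟨c • u₁, c • u₂, contDiffOn_const.smul h₁, contDiffOn_const.smul h₂, by simp [h0],
      ?_, ?_, ?_, ?_⟩
    · exact (Lp.coeFn_smul _ _).trans (hx1.const_smul c)
    · exact (Lp.coeFn_smul _ _).trans (hx2.const_smul c)
    · refine (Lp.coeFn_smul _ _).trans ((hx3.const_smul c).trans ?_)
      refine Filter.Eventually.of_forall fun ρ => ?_
      simp only [hd, Pi.smul_apply, smul_eq_mul]
      ring
    · refine (Lp.coeFn_smul _ _).trans ((hx4.const_smul c).trans ?_)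
      refine Filter.Eventually.of_forall fun ρ => ?_
      simp only [hd, Pi.smul_apply, smul_eq_mul]
      ring

/-- The densely defined operator `(u₁, u₂) ↦ (-ρ u₁' + u₂', u₁' - ρ u₂')` on `L²(0,1)²` with domain
`{u ∈ C¹[0,1]² : u₁(0) = 0}`. -/
def classicalOp : StateSpace →ₗ.[ℂ] StateSpace := classicalGraph.toLinearPMap

/-- The free operator `L₀`: the closure of `classicalOp`. -/
def freeOp : StateSpace →ₗ.[ℂ] StateSpace := classicalOp.closure

/-! ### `classicalOp` has the prescribed graph and is closable -/

theorem continuous_integral_mul {g : ℝ → ℂ} (hg : Continuous g) :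
    Continuous fun f : L2Unit => ∫ x, g x * f x ∂unitMeasure := by
  have hm : MemLp (fun x => star (g x)) 2 unitMeasure := by
    have hc : Continuous fun x => star (g x) := hg.star
    obtain ⟨C, hC⟩ := (isCompact_Icc (a := (0 : ℝ)) (b := 1)).exists_bound_of_continuousOn
      hc.continuousOn
    refine MemLp.of_bound hc.aestronglyMeasurable C ?_
    filter_upwards [ae_restrict_mem measurableSet_Ioo] with x hx
    exact hC x (Ioo_subset_Icc_self hx)
  have h : (fun f : L2Unit => ∫ x, g x * f x ∂unitMeasure) =
      fun f => inner ℂ (hm.toLp _) f := by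
    funext f
    rw [L2.inner_def]
    refine integral_congr_ae ?_
    filter_upwards [hm.coeFn_toLp] with x hx
    rw [hx]
    simp [mul_comm]
  rw [h]
  fun_prop

theorem integral_test_mul_deriv {φ : ℝ → ℝ} (hφ : ContDiff ℝ ∞ φ)
    (hs : tsupport φ ⊆ Ioo 0 1) {v : ℝ → ℂ} (hv : ContDiffOn ℝ 1 v (Icc 0 1)) :
    ∫ x, (φ x : ℂ) * derivUnit v x ∂unitMeasure =
      -∫ x, ((deriv φ x : ℝ) : ℂ) * v x ∂unitMeasure := by
  have hI : ∀ F : ℝ → ℂ, ∫ x, F x ∂unitMeasure = ∫ x in (0 : ℝ)..1, F x := by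
    intro F
    rw [intervalIntegral.integral_of_le zero_le_one, integral_Ioc_eq_integral_Ioo]
  have hφ0 : φ 0 = 0 := image_eq_zero_of_notMem_tsupport fun h => lt_irrefl _ (hs h).1
  have hφ1 : φ 1 = 0 := image_eq_zero_of_notMem_tsupport fun h => lt_irrefl _ (hs h).2
  have hu : uIcc (0 : ℝ) 1 = Icc 0 1 := uIcc_of_le zero_le_one
  have h := intervalIntegral.integral_mul_deriv_eq_deriv_mul_of_hasDerivWithinAt
    (a := 0) (b := 1) (u := fun x => (φ x : ℂ)) (u' := fun x => ((deriv φ x : ℝ) : ℂ))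
    (v := v) (v' := derivUnit v) ?_ ?_ ?_ ?_
  · rw [hI, hI, h]
    simp [hφ0, hφ1]
  · intro x _
    exact ((hφ.differentiable (by simp)) x).hasDerivAt.ofReal_comp.hasDerivWithinAt
  · intro x hx
    rw [hu] at hx ⊢
    exact (hv.differentiableOn one_ne_zero x hx).hasDerivWithinAt
  · exact (Complex.continuous_ofReal.comp (hφ.continuous_deriv (by simp))).intervalIntegrable _ _
  · refine ContinuousOn.intervalIntegrable ?_
    rw [hu]
    exact hv.continuousOn_derivWithin (uniqueDiffOn_Icc zero_lt_one) le_rfl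

theorem classicalGraph_closure_snd_eq_zero (x : StateSpace × StateSpace)
    (hx : x ∈ classicalGraph.topologicalClosure) (h0 : x.1 = 0) : x.2 = 0 := by
  have hzero : ∀ f : L2Unit,
      (∀ φ : ℝ → ℝ, ContDiff ℝ ∞ φ → tsupport φ ⊆ Ioo 0 1 →
        ∫ x, (φ x : ℂ) * f x ∂unitMeasure = 0) → f = 0 := by
    intro f hf
    have hi : Integrable f unitMeasure := (Lp.memLp f).integrable one_le_two
    have := isOpen_Ioo.ae_eq_zero_of_integral_contDiff_smul_eq_zero (μ := volume)
      (IntegrableOn.locallyIntegrableOn hi) (fun g hg _ hs => by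
        have h1 := hf g hg hs
        rw [← h1, ← integral_indicator measurableSet_Ioo]
        refine integral_congr_ae (Filter.Eventually.of_forall fun x => ?_)
        by_cases hx : x ∈ Ioo (0 : ℝ) 1
        · simp [hx]
        · have : g x = 0 := image_eq_zero_of_notMem_tsupport fun h => hx (hs h)
          simp [this, indicator])
    refine (Lp.eq_zero_iff_ae_eq_zero).2 ?_
    exact (ae_restrict_iff' measurableSet_Ioo).2 this
  have key : ∀ φ : ℝ → ℝ, ContDiff ℝ ∞ φ → tsupport φ ⊆ Ioo 0 1 →
      ∀ y ∈ classicalGraph.topologicalClosure,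
        (∫ t, (φ t : ℂ) * y.2.fst t ∂unitMeasure =
          (∫ t, ((φ t : ℂ) + t * (deriv φ t : ℝ)) * y.1.fst t ∂unitMeasure) -
            ∫ t, ((deriv φ t : ℝ) : ℂ) * y.1.snd t ∂unitMeasure) ∧
        (∫ t, (φ t : ℂ) * y.2.snd t ∂unitMeasure =
          (∫ t, ((φ t : ℂ) + t * (deriv φ t : ℝ)) * y.1.snd t ∂unitMeasure) -
            ∫ t, ((deriv φ t : ℝ) : ℂ) * y.1.fst t ∂unitMeasure) := by
    intro φ hφ hs
    have c1 : Continuous fun t => (φ t : ℂ) := Complex.continuous_ofReal.comp hφ.continuous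
    have c2 : Continuous fun t => ((deriv φ t : ℝ) : ℂ) :=
      Complex.continuous_ofReal.comp (hφ.continuous_deriv (by simp))
    have c3 : Continuous fun t : ℝ => (φ t : ℂ) + t * ((deriv φ t : ℝ) : ℂ) := by fun_prop
    have C1 := continuous_integral_mul c1
    have C2 := continuous_integral_mul c2
    have C3 := continuous_integral_mul c3
    have p11 : Continuous fun y : StateSpace × StateSpace => y.1.fst :=
      (WithLp.fstL 2 ℂ L2Unit L2Unit).continuous.comp continuous_fst
    have p12 : Continuous fun y : StateSpace × StateSpace => y.1.snd :=
      (WithLp.sndL 2 ℂ L2Unit L2Unit).continuous.comp continuous_fst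
    have p21 : Continuous fun y : StateSpace × StateSpace => y.2.fst :=
      (WithLp.fstL 2 ℂ L2Unit L2Unit).continuous.comp continuous_snd
    have p22 : Continuous fun y : StateSpace × StateSpace => y.2.snd :=
      (WithLp.sndL 2 ℂ L2Unit L2Unit).continuous.comp continuous_snd
    have hcl := (isClosed_eq (C1.comp p21) ((C3.comp p11).sub (C2.comp p12))).inter
      (isClosed_eq (C1.comp p22) ((C3.comp p12).sub (C2.comp p11)))
    refine fun y hy => closure_minimal ?_ hcl hy
    rintro y ⟨u₁, u₂, h₁, h₂, -, e1, e2, e3, e4⟩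
    have hint : ∀ F : ℝ → ℂ, ContinuousOn F (Icc 0 1) → Integrable F unitMeasure := fun F hF =>
      (hF.integrableOn_Icc).mono_set Ioo_subset_Icc_self
    have hd : ∀ {w : ℝ → ℂ}, ContDiffOn ℝ 1 w (Icc 0 1) →
        ContinuousOn (derivUnit w) (Icc 0 1) := fun hw =>
      hw.continuousOn_derivWithin (uniqueDiffOn_Icc zero_lt_one) le_rfl
    have ct : Continuous fun t : ℝ => (t : ℂ) := Complex.continuous_ofReal
    have parts : ∀ {w z : ℝ → ℂ}, ContDiffOn ℝ 1 w (Icc 0 1) → ContDiffOn ℝ 1 z (Icc 0 1) →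
        ∫ t, (φ t : ℂ) * (-(t : ℂ) * derivUnit w t + derivUnit z t) ∂unitMeasure =
          (∫ t, ((φ t : ℂ) + t * (deriv φ t : ℝ)) * w t ∂unitMeasure) -
            ∫ t, ((deriv φ t : ℝ) : ℂ) * z t ∂unitMeasure := by
      intro w z hw hz
      have htw : ContDiffOn ℝ 1 (fun t : ℝ => (t : ℂ) * w t) (Icc 0 1) :=
        (Complex.ofRealCLM.contDiff.contDiffOn).mul hw
      have hdt : ∀ t ∈ Icc (0 : ℝ) 1,
          derivUnit (fun t : ℝ => (t : ℂ) * w t) t = w t + t * derivUnit w t := by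
        intro t ht
        have h1 : HasDerivWithinAt (fun t : ℝ => (t : ℂ)) 1 (Icc 0 1) t :=
          (hasDerivAt_id t).ofReal_comp.hasDerivWithinAt
        have h2 := h1.mul (hw.differentiableOn one_ne_zero t ht).hasDerivWithinAt
        have h3 := h2.derivWithin (uniqueDiffOn_Icc zero_lt_one t ht)
        rw [one_mul] at h3
        exact h3
      have i1 := integral_test_mul_deriv hφ hs htw
      have i2 := integral_test_mul_deriv hφ hs hz
      have k1 : Integrable (fun t => (φ t : ℂ) * w t) unitMeasure :=
        hint _ (c1.continuousOn.mul hw.continuousOn)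
      have k2 : Integrable (fun t => (φ t : ℂ) * derivUnit (fun t : ℝ => (t : ℂ) * w t) t)
          unitMeasure := hint _ (c1.continuousOn.mul (hd htw))
      have k3 : Integrable (fun t => (φ t : ℂ) * derivUnit z t) unitMeasure :=
        hint _ (c1.continuousOn.mul (hd hz))
      have k4 : Integrable (fun t => ((deriv φ t : ℝ) : ℂ) * ((t : ℂ) * w t)) unitMeasure :=
        hint _ (c2.continuousOn.mul (ct.continuousOn.mul hw.continuousOn))
      have e : ∫ t, (φ t : ℂ) * (-(t : ℂ) * derivUnit w t + derivUnit z t) ∂unitMeasure =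
          (∫ t, (φ t : ℂ) * w t ∂unitMeasure) -
            (∫ t, (φ t : ℂ) * derivUnit (fun t : ℝ => (t : ℂ) * w t) t ∂unitMeasure) +
            ∫ t, (φ t : ℂ) * derivUnit z t ∂unitMeasure := by
        rw [← integral_sub k1 k2]
        refine Eq.trans (integral_congr_ae ?_) (integral_add (k1.sub k2) k3)
        filter_upwards [ae_restrict_mem measurableSet_Ioo] with t ht
        simp only [hdt t (Ioo_subset_Icc_self ht)]
        ring
      have e' : ∫ t, ((φ t : ℂ) + t * (deriv φ t : ℝ)) * w t ∂unitMeasure =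
          (∫ t, (φ t : ℂ) * w t ∂unitMeasure) +
            ∫ t, ((deriv φ t : ℝ) : ℂ) * ((t : ℂ) * w t) ∂unitMeasure := by
        rw [← integral_add k1 k4]
        refine integral_congr_ae (Filter.Eventually.of_forall fun t => ?_)
        simp only
        ring
      rw [e, i1, i2, e']
      ring
    have hco : ∀ {g F G : ℝ → ℂ}, F =ᵐ[unitMeasure] G →
        ∫ t, g t * F t ∂unitMeasure = ∫ t, g t * G t ∂unitMeasure := by
      intro g F G h
      refine integral_congr_ae ?_
      filter_upwards [h] with t ht
      rw [ht]
    constructor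
    · change ∫ t, (φ t : ℂ) * y.2.fst t ∂unitMeasure =
          (∫ t, ((φ t : ℂ) + t * (deriv φ t : ℝ)) * y.1.fst t ∂unitMeasure) -
            ∫ t, ((deriv φ t : ℝ) : ℂ) * y.1.snd t ∂unitMeasure
      rw [hco e3, hco e1, hco e2]
      exact parts h₁ h₂
    · change ∫ t, (φ t : ℂ) * y.2.snd t ∂unitMeasure =
          (∫ t, ((φ t : ℂ) + t * (deriv φ t : ℝ)) * y.1.snd t ∂unitMeasure) -
            ∫ t, ((deriv φ t : ℝ) : ℂ) * y.1.fst t ∂unitMeasure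
      rw [hco e4, hco e1, hco e2, ← parts h₂ h₁]
      refine integral_congr_ae (Filter.Eventually.of_forall fun t => ?_)
      simp only
      ring
  have hz : ∀ g : ℝ → ℂ, ∫ t, g t * (0 : L2Unit) t ∂unitMeasure = 0 := by
    intro g
    refine integral_eq_zero_of_ae ?_
    filter_upwards [Lp.coeFn_zero ℂ 2 unitMeasure] with t ht
    rw [ht]
    simp
  have a1 : x.2.fst = 0 := hzero _ fun φ hφ hs => by
    have := (key φ hφ hs x hx).1
    rw [this, h0, WithLp.zero_fst, WithLp.zero_snd, hz, hz, sub_zero]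
  have a2 : x.2.snd = 0 := hzero _ fun φ hφ hs => by
    have := (key φ hφ hs x hx).2
    rw [this, h0, WithLp.zero_fst, WithLp.zero_snd, hz, hz, sub_zero]
  exact (WithLp.ofLp_injective 2) (Prod.ext a1 a2)

theorem classicalOp_graph : classicalOp.graph = classicalGraph :=
  Submodule.toLinearPMap_graph_eq _ fun x hx h0 =>
    classicalGraph_closure_snd_eq_zero x (classicalGraph.le_topologicalClosure hx) h0

theorem classicalOp_isClosable : classicalOp.IsClosable :=
  ⟨classicalGraph.topologicalClosure.toLinearPMap, by
    rw [classicalOp_graph, Submodule.toLinearPMap_graph_eq _ classicalGraph_closure_snd_eq_zero]⟩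

/-! ## The linearized operator -/

theorem intervalIntegrable_unit (u : L2Unit) {ρ : ℝ} (hρ : ρ ∈ Ioo (0 : ℝ) 1) :
    IntervalIntegrable u volume 0 ρ := by
  have hi : Integrable u unitMeasure := (Lp.memLp u).integrable one_le_two
  rw [intervalIntegrable_iff_integrableOn_Ioc_of_le hρ.1.le]
  exact IntegrableOn.mono_set hi fun x hx => ⟨hx.1, hx.2.trans_lt hρ.2⟩

theorem integral_unit_congr {F G : ℝ → ℂ} (h : F =ᵐ[unitMeasure] G) {ρ : ℝ}
    (hρ : ρ ∈ Ioo (0 : ℝ) 1) : ∫ ξ in (0 : ℝ)..ρ, F ξ = ∫ ξ in (0 : ℝ)..ρ, G ξ := by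
  rw [intervalIntegral.integral_of_le hρ.1.le, intervalIntegral.integral_of_le hρ.1.le]
  exact integral_congr_ae
    (ae_restrict_of_ae_restrict_of_subset (s := Ioc 0 ρ) (t := Ioo 0 1)
      (fun x hx => ⟨hx.1, hx.2.trans_lt hρ.2⟩) h)

theorem norm_primitive_le (u : L2Unit) {ρ : ℝ} (hρ : ρ ∈ Ioo (0 : ℝ) 1) :
    ‖∫ ξ in (0 : ℝ)..ρ, u ξ‖ ≤ ‖u‖ := by
  have hi : Integrable u unitMeasure := (Lp.memLp u).integrable one_le_two
  have h1 : ‖∫ ξ in (0 : ℝ)..ρ, u ξ‖ ≤ ∫ ξ, ‖u ξ‖ ∂unitMeasure := by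
    refine (intervalIntegral.norm_integral_le_integral_norm hρ.1.le).trans ?_
    rw [intervalIntegral.integral_of_le hρ.1.le]
    refine setIntegral_mono_set (IntegrableOn.integrable hi.norm)
      (Filter.Eventually.of_forall fun _ => norm_nonneg _) ?_
    exact (show Ioc 0 ρ ⊆ Ioo (0 : ℝ) 1 from
      fun x hx => ⟨hx.1, hx.2.trans_lt hρ.2⟩).eventuallyLE
  have h2 : ∫ ξ, ‖u ξ‖ ∂unitMeasure = (eLpNorm u 1 unitMeasure).toReal := by
    rw [eLpNorm_one_eq_lintegral_enorm, integral_norm_eq_lintegral_enorm hi.1]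
  have : IsProbabilityMeasure unitMeasure := ⟨by simp⟩
  rw [h2] at h1
  refine h1.trans ?_
  rw [Lp.norm_def]
  exact ENNReal.toReal_mono (Lp.eLpNorm_ne_top u)
    (eLpNorm_le_eLpNorm_of_exponent_le one_le_two (Lp.aestronglyMeasurable u))

theorem memLp_primitive (u : L2Unit) :
    MemLp (fun ρ : ℝ => ∫ ξ in (0 : ℝ)..ρ, u ξ) 2 unitMeasure := by
  have hi : IntegrableOn u (Icc 0 1) volume :=
    (integrableOn_Icc_iff_integrableOn_Ioo).2 ((Lp.memLp u).integrable one_le_two)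
  have hc : ContinuousOn (fun ρ : ℝ => ∫ ξ in (0 : ℝ)..ρ, u ξ) (Icc 0 1) := by
    have := intervalIntegral.continuousOn_primitive_interval (a := 0) (b := 1) (f := u)
      (μ := volume) (by rwa [uIcc_of_le zero_le_one])
    rwa [uIcc_of_le zero_le_one] at this
  refine MemLp.of_bound ((hc.mono Ioo_subset_Icc_self).aestronglyMeasurable measurableSet_Ioo)
    ‖u‖ ?_
  filter_upwards [ae_restrict_mem measurableSet_Ioo] with ρ hρ
  exact norm_primitive_le u hρ

/-- The Volterra operator `u ↦ ∫₀^ρ u(ξ) dξ` on `L²(0,1)`. -/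
def volterra : L2Unit →L[ℂ] L2Unit :=
  LinearMap.mkContinuous
    { toFun := fun u => (memLp_primitive u).toLp _
      map_add' := fun u v => by
        refine Lp.ext ?_
        refine (memLp_primitive _).coeFn_toLp.trans (.trans ?_ (Lp.coeFn_add _ _).symm)
        filter_upwards [(memLp_primitive u).coeFn_toLp, (memLp_primitive v).coeFn_toLp,
          ae_restrict_mem measurableSet_Ioo] with ρ h1 h2 hρ
        rw [Pi.add_apply, h1, h2, ← intervalIntegral.integral_add
          (intervalIntegrable_unit u hρ) (intervalIntegrable_unit v hρ)]
        exact integral_unit_congr (Lp.coeFn_add u v) hρ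
      map_smul' := fun c u => by
        refine Lp.ext ?_
        refine (memLp_primitive _).coeFn_toLp.trans (.trans ?_ (Lp.coeFn_smul _ _).symm)
        filter_upwards [(memLp_primitive u).coeFn_toLp,
          ae_restrict_mem measurableSet_Ioo] with ρ h1 hρ
        rw [Pi.smul_apply, RingHom.id_apply, h1, ← intervalIntegral.integral_smul]
        exact integral_unit_congr (Lp.coeFn_smul c u) hρ }
    1 (fun u => by
      rw [one_mul]
      have hb := Lp.norm_le_of_ae_bound (f := (memLp_primitive u).toLp _) (norm_nonneg u) (by
        filter_upwards [(memLp_primitive u).coeFn_toLp,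
          ae_restrict_mem measurableSet_Ioo] with ρ h1 hρ
        rw [h1]
        exact norm_primitive_le u hρ)
      simpa [measureUnivNNReal] using hb)

theorem volterra_ae_eq (u : L2Unit) :
    volterra u =ᵐ[unitMeasure] fun ρ => ∫ ξ in (0 : ℝ)..ρ, u ξ :=
  (memLp_primitive u).coeFn_toLp

/-- The constant `c₀ = 2(p+1)/(p-1)²`. -/
def c₀ (p : ℕ) : ℝ := 2 * ((p : ℝ) + 1) / ((p : ℝ) - 1) ^ 2

/-- The bounded perturbation `L' (u₁, u₂) = (p c₀ ∫₀^ρ u₂(ξ) dξ, 0)` on `L²(0,1)²`. -/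
def perturbation (p : ℕ) : StateSpace →L[ℂ] StateSpace :=
  ((WithLp.prodContinuousLinearEquiv 2 ℂ L2Unit L2Unit).symm : L2Unit × L2Unit →L[ℂ] StateSpace) ∘L
    (((p * c₀ p : ℝ) : ℂ) • (ContinuousLinearMap.inl ℂ L2Unit L2Unit ∘L volterra ∘L
      WithLp.sndL 2 ℂ L2Unit L2Unit))

theorem perturbation_apply (p : ℕ) (u : StateSpace) :
    perturbation p u = WithLp.toLp 2 (((p * c₀ p : ℝ) : ℂ) • volterra u.snd, 0) := by
  simp [perturbation, ← WithLp.toLp_smul]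

/-- The linearized operator `L = L₀ + L'`, with the domain of `L₀`. -/
def linearizedOp (p : ℕ) : StateSpace →ₗ.[ℂ] StateSpace :=
  (perturbation p : StateSpace →ₗ[ℂ] StateSpace) +ᵥ freeOp

end

/-! Both eigenvalue problems have the form `(z - L₀) u = (κ ∫₀^ρ u₂, 0)`, with κ = 0 for `freeOp`
and κ = p c₀ for `linearizedOp`. Integrating once gives u₁ = ρ u₂ + (z - 1) ∫₀^ρ u₂, and u₂ solves
an integrated second order equation that is singular at ρ = 1 (`isFreePair_smul_sub_iff`). The
condition u₁(0) = 0 leaves only multiples of one even power series in ρ, `eigSeries`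
(`ae_eq_mul_eigSeries`, a Grönwall argument), whose coefficients satisfy d_{k+1} / d_k = ((z + 2k)(z
+ 2k + 1) - κ) / ((2k + 1)(2k + 2)).

The question is therefore when this series lies in L²(0,1). Comparison with the binomial series of
(1 - ρ²)^(-a) shows that it does if Re z < 1/2 (`memLp_eigSeries`). If Re z ≥ 1/2 and no factor (z +
2k)(z + 2k + 1) - κ vanishes, then it behaves like L (1 - ρ²)^(-z) with L ≠ 0 near ρ = 1 and is not
square integrable (`not_memLp_eigSeries`). So an eigenvalue with Re z ≥ 1/2 forces the series to
terminate. For κ = 0 this is impossible. For κ = p c₀ = λ(λ + 1) with λ = 1 + 2/(p - 1) ≤ 2 it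
happens only for z = λ and k = 0, where u = (λρ, 1) is an eigenfunction.

For the spectra, `L₀ - 1/2` is dissipative and `z - L₀` is onto for Re z > 1/2, so σ(L₀) lies in {Re
z ≤ 1/2}. Every z with Re z < 1/2 is an eigenvalue of L, and the spectrum is closed, so σ(L)
contains that closed half-plane.

Since `freeOp` is a closure, all this rests on a description of its graph by bounded operators:
`mem_freeOp_graph_iff` identifies it with the pairs satisfying `IsFreePair`. -/

/-! ## Spectra of unbounded operators -/

theorem pointSpectrum_subset_opSpectrum {E : Type*} [NormedAddCommGroup E] [NormedSpace ℂ E]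
    (T : E →ₗ.[ℂ] E) : pointSpectrum T ⊆ opSpectrum T := by
  rintro z ⟨u, hu, h⟩ ⟨R, -, hR⟩
  have := hR u
  rw [h, sub_self, map_zero] at this
  exact hu (Subtype.ext this.symm)

/-- Neumann series: `z' - T = W (z - T)` with `W = 1 - (z - z') R`, which is invertible for `z'`
near `z`, so `R W⁻¹` is the resolvent at `z'`. The radius uses `‖R‖ + 1` so that `R = 0` needs no
separate case. -/
theorem isOpen_opResolventSet {E : Type*} [NormedAddCommGroup E] [NormedSpace ℂ E]
    [CompleteSpace E] (T : E →ₗ.[ℂ] E) : IsOpen (opResolventSet T) := by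
  rw [Metric.isOpen_iff]
  rintro z ⟨R, h1, h2⟩
  refine ⟨(‖R‖ + 1)⁻¹, by positivity, fun z' hz' => ?_⟩
  have hsm : ‖(z - z') • R‖ < 1 := by
    rw [norm_smul, ← dist_eq_norm, dist_comm]
    rw [Metric.mem_ball] at hz'
    calc dist z' z * ‖R‖ ≤ (‖R‖ + 1)⁻¹ * ‖R‖ := by gcongr
      _ < (‖R‖ + 1)⁻¹ * (‖R‖ + 1) := by gcongr; linarith
      _ = 1 := inv_mul_cancel₀ (by positivity)
  set W := Units.oneSub ((z - z') • R) hsm with hW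
  have hWval : ∀ x, (W : E →L[ℂ] E) x = x - (z - z') • R x := fun x => by
    simp [hW, Units.val_oneSub]
  have hr : ∀ x, (W : E →L[ℂ] E) ((↑W⁻¹ : E →L[ℂ] E) x) = x := fun x => by
    rw [← mul_apply_eq_comp, Units.mul_inv, one_apply_eq_self]
  have hl : ∀ x, (↑W⁻¹ : E →L[ℂ] E) ((W : E →L[ℂ] E) x) = x := fun x => by
    rw [← mul_apply_eq_comp, Units.inv_mul, one_apply_eq_self]
  refine ⟨R * ↑W⁻¹, fun f => ?_, fun u => ?_⟩
  · obtain ⟨u, hu, hu'⟩ := h1 ((↑W⁻¹ : E →L[ℂ] E) f)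
    refine ⟨u, hu, ?_⟩
    have h3 := hr f
    rw [hWval, ← hu, ← hu'] at h3
    rw [← h3]
    module
  · have h3 := h2 u
    have h4 : z' • (u : E) - T u = (W : E →L[ℂ] E) (z • (u : E) - T u) := by
      rw [hWval, h3]
      module
    rw [h4, mul_apply_eq_comp, hl, h3]

/-- The resolvent set of an operator contains every `z` for which `z - T` is onto and
bounded below. -/
theorem mem_opResolventSet_of_surjective {E : Type*} [NormedAddCommGroup E] [NormedSpace ℂ E]
    {T : E →ₗ.[ℂ] E} {z : ℂ} {c : ℝ} (hc : 0 < c)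
    (hb : ∀ u : T.domain, c * ‖(u : E)‖ ≤ ‖z • (u : E) - T u‖)
    (hs : ∀ f : E, ∃ u : T.domain, z • (u : E) - T u = f) : z ∈ opResolventSet T := by
  let A : T.domain →ₗ[ℂ] E := z • T.domain.subtype - T.toFun
  have hA : ∀ u, A u = z • (u : E) - T u := fun u => rfl
  have hinj : Function.Injective A := by
    rw [injective_iff_map_eq_zero]
    intro u hu
    have := hb u
    rw [← hA, hu, norm_zero] at this
    have h0 : ‖(u : E)‖ = 0 := le_antisymm (by nlinarith) (norm_nonneg _)
    exact Subtype.ext (norm_eq_zero.1 h0)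
  let e := LinearEquiv.ofBijective A ⟨hinj, hs⟩
  have he : ∀ u, e u = z • (u : E) - T u := fun u => rfl
  refine ⟨LinearMap.mkContinuous (T.domain.subtype ∘ₗ e.symm.toLinearMap) c⁻¹ fun f => ?_,
    fun f => ⟨e.symm f, rfl, ?_⟩, fun u => ?_⟩
  · have := hb (e.symm f)
    rw [← he, LinearEquiv.apply_symm_apply] at this
    simp only [LinearMap.coe_comp, Function.comp_apply, LinearEquiv.coe_coe, Submodule.coe_subtype]
    rw [inv_mul_eq_div, le_div_iff₀ hc]
    linarith
  · rw [← he, LinearEquiv.apply_symm_apply]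
  · rw [← he]
    simp

/-! ## Multiplication and integration operators on `L²(0,1)` -/

theorem integral_unitMeasure (F : ℝ → ℂ) : ∫ x, F x ∂unitMeasure = ∫ x in (0 : ℝ)..1, F x := by
  rw [intervalIntegral.integral_of_le zero_le_one, integral_Ioc_eq_integral_Ioo]

theorem ae_mem_Ioo : ∀ᵐ ρ ∂unitMeasure, ρ ∈ Ioo (0 : ℝ) 1 := ae_restrict_mem measurableSet_Ioo

theorem memLp_unit_of_continuousOn {f : ℝ → ℂ} (hf : ContinuousOn f (Icc 0 1)) (q : ENNReal) :
    MemLp f q unitMeasure := by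
  obtain ⟨C, hC⟩ := (isCompact_Icc (a := (0 : ℝ)) (b := 1)).exists_bound_of_continuousOn hf
  refine MemLp.of_bound ((hf.mono Ioo_subset_Icc_self).aestronglyMeasurable measurableSet_Ioo) C ?_
  filter_upwards [ae_mem_Ioo] with x hx
  exact hC x (Ioo_subset_Icc_self hx)

/-- Multiplication by the independent variable on `L²(0,1)`. -/
noncomputable def mulId : L2Unit →L[ℂ] L2Unit :=
  (ContinuousLinearMap.mul ℂ ℂ).holderL unitMeasure ⊤ 2 2
    ((memLp_unit_of_continuousOn Complex.continuous_ofReal.continuousOn ⊤).toLp _)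

theorem mulId_ae_eq (f : L2Unit) : mulId f =ᵐ[unitMeasure] fun ρ => (ρ : ℂ) * f ρ := by
  refine ((ContinuousLinearMap.mul ℂ ℂ).coeFn_holder _ f).trans ?_
  filter_upwards [(memLp_unit_of_continuousOn
    Complex.continuous_ofReal.continuousOn ⊤).coeFn_toLp] with ρ h
  simp [h]

/-- The constant function `1` in `L²(0,1)`. -/
noncomputable def constOne : L2Unit :=
  (memLp_unit_of_continuousOn (continuousOn_const (c := (1 : ℂ))) 2).toLp _

theorem constOne_ae_eq : constOne =ᵐ[unitMeasure] fun _ => 1 := MemLp.coeFn_toLp _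

theorem integrable_unit (f : L2Unit) : Integrable f unitMeasure :=
  (Lp.memLp f).integrable one_le_two

/-- Integration over `(0,1)` as a functional on `L²(0,1)`. -/
noncomputable def totalInt : L2Unit →L[ℂ] ℂ where
  toFun f := ∫ x, f x ∂unitMeasure
  map_add' f g := by
    rw [← integral_add (integrable_unit f) (integrable_unit g)]
    exact integral_congr_ae (Lp.coeFn_add f g)
  map_smul' c f := by
    rw [RingHom.id_apply, ← integral_smul]
    exact integral_congr_ae (Lp.coeFn_smul c f)
  cont := by simpa using continuous_integral_mul (continuous_const (y := (1 : ℂ)))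

theorem totalInt_apply (f : L2Unit) : totalInt f = ∫ x, f x ∂unitMeasure := rfl

theorem L2Unit_ext {f g : L2Unit} {F G : ℝ → ℂ} (hf : f =ᵐ[unitMeasure] F)
    (hg : g =ᵐ[unitMeasure] G) (h : ∀ ρ ∈ Ioo (0 : ℝ) 1, F ρ = G ρ) : f = g := by
  refine Lp.ext ?_
  filter_upwards [hf, hg, ae_mem_Ioo] with ρ h1 h2 hρ
  rw [h1, h2, h ρ hρ]

/-! ## Description of the graph of the free operator by integral equations -/

/-- The integrated form of `g = (-ρ u₁' + u₂', u₁' - ρ u₂')`, `u₁(0) = 0`,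
with `(1 - ρ) (u₁ + u₂)` vanishing at `ρ = 1`. -/
def IsFreePair (x : StateSpace × StateSpace) : Prop :=
  x.1.fst - mulId x.1.snd = volterra (x.2.snd - x.1.snd) ∧
  x.1.snd - mulId x.1.fst = volterra (x.2.fst - x.1.fst) -
    totalInt (x.2.fst - x.1.fst + (x.2.snd - x.1.snd)) • constOne

theorem integral_eq_sub_of_hasDerivAt_unit {E : Type*} [NormedAddCommGroup E] [NormedSpace ℝ E]
    [CompleteSpace E] {w F : ℝ → E} (hw : ContinuousOn w (Icc 0 1))
    (hF : ContinuousOn F (Icc 0 1)) (hd : ∀ x ∈ Ioo (0 : ℝ) 1, HasDerivAt w (F x) x) {ρ : ℝ}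
    (hρ : ρ ∈ Icc (0 : ℝ) 1) : ∫ x in (0 : ℝ)..ρ, F x = w ρ - w 0 := by
  refine intervalIntegral.integral_eq_sub_of_hasDerivAt_of_le hρ.1
    (hw.mono (Icc_subset_Icc_right hρ.2)) (fun x hx => hd x ⟨hx.1, hx.2.trans_le hρ.2⟩) ?_
  refine ContinuousOn.intervalIntegrable ?_
  rw [uIcc_of_le hρ.1]
  exact hF.mono (Icc_subset_Icc_right hρ.2)

theorem hasDerivAt_derivUnit {u : ℝ → ℂ} (hu : ContDiffOn ℝ 1 u (Icc 0 1)) {x : ℝ}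
    (hx : x ∈ Ioo (0 : ℝ) 1) : HasDerivAt u (derivUnit u x) x :=
  (hu.differentiableOn one_ne_zero x (Ioo_subset_Icc_self hx)).hasDerivWithinAt.hasDerivAt
    (Icc_mem_nhds hx.1 hx.2)

theorem continuousOn_derivUnit {u : ℝ → ℂ} (hu : ContDiffOn ℝ 1 u (Icc 0 1)) :
    ContinuousOn (derivUnit u) (Icc 0 1) :=
  hu.continuousOn_derivWithin (uniqueDiffOn_Icc zero_lt_one) le_rfl

/-- For g = L₀ u one has (u₁ - ρ u₂)' = g₂ - u₂ and (u₂ - ρ u₁)' = g₁ - u₁. The first primitive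
starts at 0 because u₁(0) = 0. The second starts at u₂(0), which is not continuous in the L² norm.
Writing it as a bounded functional of u and g is what makes `IsFreePair` a closed condition. -/
theorem isFreePair_of_mem_classicalGraph {x : StateSpace × StateSpace}
    (hx : x ∈ classicalGraph) : IsFreePair x := by
  obtain ⟨u₁, u₂, h₁, h₂, h0, e1, e2, e3, e4⟩ := hx
  have ci : ContinuousOn (fun ρ : ℝ => (ρ : ℂ)) (Icc 0 1) := Complex.continuous_ofReal.continuousOn
  have c1 := h₁.continuousOn
  have c2 := h₂.continuousOn
  have c3 := continuousOn_derivUnit h₁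
  have c4 := continuousOn_derivUnit h₂
  have hid : ∀ x : ℝ, HasDerivAt (fun ρ : ℝ => (ρ : ℂ)) 1 x := fun x =>
    (hasDerivAt_id x).ofReal_comp
  set F : ℝ → ℂ := fun ρ => derivUnit u₁ ρ - (ρ : ℂ) * derivUnit u₂ ρ - u₂ ρ with hF
  set G : ℝ → ℂ := fun ρ => -(ρ : ℂ) * derivUnit u₁ ρ + derivUnit u₂ ρ - u₁ ρ with hG
  have hFi : ∀ ρ ∈ Icc (0 : ℝ) 1, ∫ ξ in (0 : ℝ)..ρ, F ξ = u₁ ρ - ρ * u₂ ρ := by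
    intro ρ hρ
    have := integral_eq_sub_of_hasDerivAt_unit (w := fun ρ => u₁ ρ - ρ * u₂ ρ) (F := F)
      (by fun_prop) (by fun_prop) (fun x hx => by
        convert! (hasDerivAt_derivUnit h₁ hx).sub ((hid x).mul (hasDerivAt_derivUnit h₂ hx)) using 1
        simp only [hF]; ring) hρ
    simpa [h0] using this
  have hGi : ∀ ρ ∈ Icc (0 : ℝ) 1, ∫ ξ in (0 : ℝ)..ρ, G ξ = u₂ ρ - ρ * u₁ ρ - u₂ 0 := by
    intro ρ hρ
    have := integral_eq_sub_of_hasDerivAt_unit (w := fun ρ => u₂ ρ - ρ * u₁ ρ) (F := G)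
      (by fun_prop) (by fun_prop) (fun x hx => by
        convert! (hasDerivAt_derivUnit h₂ hx).sub ((hid x).mul (hasDerivAt_derivUnit h₁ hx)) using 1
        simp only [hG]; ring) hρ
    simpa using this
  have a1 : x.2.snd - x.1.snd =ᵐ[unitMeasure] F := by
    filter_upwards [Lp.coeFn_sub x.2.snd x.1.snd, e4, e2] with ρ k1 k2 k3
    rw [k1, Pi.sub_apply, k2, k3]
  have a2 : x.2.fst - x.1.fst =ᵐ[unitMeasure] G := by
    filter_upwards [Lp.coeFn_sub x.2.fst x.1.fst, e3, e1] with ρ k1 k2 k3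
    rw [k1, Pi.sub_apply, k2, k3]
  have hint : ∀ {H : ℝ → ℂ}, ContinuousOn H (Icc 0 1) → Integrable H unitMeasure := fun hH =>
    (memLp_unit_of_continuousOn hH 1).integrable le_rfl
  -- The two primitives add up to (1 - ρ)(u₁ + u₂) - u₂(0), which equals -u₂(0) at ρ = 1.
  have hT : totalInt (x.2.fst - x.1.fst + (x.2.snd - x.1.snd)) = -u₂ 0 := by
    rw [map_add, totalInt_apply, totalInt_apply, integral_congr_ae a1, integral_congr_ae a2,
      integral_unitMeasure, integral_unitMeasure, hFi 1 (by simp), hGi 1 (by simp)]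
    push_cast
    ring
  refine ⟨?_, ?_⟩
  · refine L2Unit_ext (F := fun ρ => u₁ ρ - ρ * u₂ ρ) (G := fun ρ => ∫ ξ in (0 : ℝ)..ρ, F ξ) ?_ ?_
      fun ρ hρ => (hFi ρ (Ioo_subset_Icc_self hρ)).symm
    · filter_upwards [Lp.coeFn_sub x.1.fst (mulId x.1.snd), mulId_ae_eq x.1.snd, e1, e2]
        with ρ k1 k2 k3 k4
      rw [k1, Pi.sub_apply, k2, k3, k4]
    · filter_upwards [volterra_ae_eq (x.2.snd - x.1.snd), ae_mem_Ioo] with ρ k1 hρ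
      rw [k1, integral_unit_congr a1 hρ]
  · rw [hT, neg_smul, sub_neg_eq_add]
    refine L2Unit_ext (F := fun ρ => u₂ ρ - ρ * u₁ ρ)
      (G := fun ρ => (∫ ξ in (0 : ℝ)..ρ, G ξ) + u₂ 0) ?_ ?_
      fun ρ hρ => by rw [hGi ρ (Ioo_subset_Icc_self hρ)]; ring
    · filter_upwards [Lp.coeFn_sub x.1.snd (mulId x.1.fst), mulId_ae_eq x.1.fst, e1, e2]
        with ρ k1 k2 k3 k4
      rw [k1, Pi.sub_apply, k2, k3, k4]
    · filter_upwards [Lp.coeFn_add (volterra (x.2.fst - x.1.fst)) (u₂ 0 • constOne),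
        volterra_ae_eq (x.2.fst - x.1.fst), Lp.coeFn_smul (u₂ 0) constOne, constOne_ae_eq,
        ae_mem_Ioo] with ρ k1 k2 k3 k4 hρ
      rw [k1, Pi.add_apply, k2, k3, Pi.smul_apply, k4, integral_unit_congr a2 hρ]
      simp

theorem continuous_fst_fst : Continuous fun y : StateSpace × StateSpace => y.1.fst :=
  (WithLp.fstL 2 ℂ L2Unit L2Unit).continuous.comp continuous_fst

theorem continuous_fst_snd : Continuous fun y : StateSpace × StateSpace => y.1.snd :=
  (WithLp.sndL 2 ℂ L2Unit L2Unit).continuous.comp continuous_fst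

theorem continuous_snd_fst : Continuous fun y : StateSpace × StateSpace => y.2.fst :=
  (WithLp.fstL 2 ℂ L2Unit L2Unit).continuous.comp continuous_snd

theorem continuous_snd_snd : Continuous fun y : StateSpace × StateSpace => y.2.snd :=
  (WithLp.sndL 2 ℂ L2Unit L2Unit).continuous.comp continuous_snd

theorem isClosed_isFreePair : IsClosed {x | IsFreePair x} := by
  have h1 := continuous_fst_fst
  have h2 := continuous_fst_snd
  have h3 := continuous_snd_fst
  have h4 := continuous_snd_snd
  refine IsClosed.inter (isClosed_eq ?_ ?_) (isClosed_eq ?_ ?_) <;> fun_prop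

theorem freeOp_graph : freeOp.graph = classicalGraph.topologicalClosure := by
  rw [freeOp, ← classicalOp_isClosable.graph_closure_eq_closure_graph, classicalOp_graph]

theorem isFreePair_of_mem_graph {x : StateSpace × StateSpace} (hx : x ∈ freeOp.graph) :
    IsFreePair x := by
  rw [freeOp_graph] at hx
  exact closure_minimal (fun y hy => isFreePair_of_mem_classicalGraph hy) isClosed_isFreePair hx

/-! ## Dissipativity of the free operator -/

/-- The real part of the integrand is the derivative of q = -ρ/2 (|u₁|² + |u₂|²) + Re(u₁ ū₂). Here
q(0) = 0 since u₁(0) = 0, and q(1) = -|u₁(1) - u₂(1)|²/2. -/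
theorem re_inner_nonpos_of_mem_classicalGraph {x : StateSpace × StateSpace}
    (hx : x ∈ classicalGraph) : (inner ℂ x.1 (x.2 - (1 / 2 : ℂ) • x.1)).re ≤ 0 := by
  obtain ⟨u₁, u₂, h₁, h₂, h0, e1, e2, e3, e4⟩ := hx
  have c1 := h₁.continuousOn
  have c2 := h₂.continuousOn
  have c3 := continuousOn_derivUnit h₁
  have c4 := continuousOn_derivUnit h₂
  have ci : ContinuousOn (fun ρ : ℝ => (ρ : ℂ)) (Icc 0 1) := Complex.continuous_ofReal.continuousOn
  set y := x.2 - (1 / 2 : ℂ) • x.1 with hy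
  set G₁ : ℝ → ℂ := fun ρ => -(ρ : ℂ) * derivUnit u₁ ρ + derivUnit u₂ ρ - 1 / 2 * u₁ ρ with hG₁
  set G₂ : ℝ → ℂ := fun ρ => derivUnit u₁ ρ - (ρ : ℂ) * derivUnit u₂ ρ - 1 / 2 * u₂ ρ with hG₂
  have k1 : y.fst =ᵐ[unitMeasure] G₁ := by
    have : y.fst = x.2.fst - (1 / 2 : ℂ) • x.1.fst := rfl
    rw [this]
    filter_upwards [Lp.coeFn_sub x.2.fst ((1 / 2 : ℂ) • x.1.fst), Lp.coeFn_smul (1 / 2 : ℂ) x.1.fst,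
      e1, e3] with ρ j1 j2 j3 j4
    rw [j1, Pi.sub_apply, j2, Pi.smul_apply, j3, j4, smul_eq_mul]
  have k2 : y.snd =ᵐ[unitMeasure] G₂ := by
    have : y.snd = x.2.snd - (1 / 2 : ℂ) • x.1.snd := rfl
    rw [this]
    filter_upwards [Lp.coeFn_sub x.2.snd ((1 / 2 : ℂ) • x.1.snd), Lp.coeFn_smul (1 / 2 : ℂ) x.1.snd,
      e2, e4] with ρ j1 j2 j3 j4
    rw [j1, Pi.sub_apply, j2, Pi.smul_apply, j3, j4, smul_eq_mul]
  have cG₁ : ContinuousOn G₁ (Icc 0 1) := by fun_prop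
  have cG₂ : ContinuousOn G₂ (Icc 0 1) := by fun_prop
  have cH : ContinuousOn (fun ρ => inner ℂ (u₁ ρ) (G₁ ρ) + inner ℂ (u₂ ρ) (G₂ ρ)) (Icc 0 1) := by
    fun_prop
  have hinner : inner ℂ x.1 y =
      ∫ ρ, (inner ℂ (u₁ ρ) (G₁ ρ) + inner ℂ (u₂ ρ) (G₂ ρ)) ∂unitMeasure := by
    rw [WithLp.prod_inner_apply, L2.inner_def, L2.inner_def,
      ← integral_add (L2.integrable_inner _ _) (L2.integrable_inner _ _)]
    refine integral_congr_ae ?_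
    filter_upwards [e1, e2, k1, k2] with ρ j1 j2 j3 j4
    rw [← j1, ← j2, ← j3, ← j4]
    rfl
  set q : ℝ → ℝ := fun ρ => -ρ / 2 * (‖u₁ ρ‖ ^ 2 + ‖u₂ ρ‖ ^ 2) + inner ℝ (u₁ ρ) (u₂ ρ) with hq
  have hq' : ∀ ρ ∈ Ioo (0 : ℝ) 1,
      HasDerivAt q (inner ℂ (u₁ ρ) (G₁ ρ) + inner ℂ (u₂ ρ) (G₂ ρ)).re ρ := by
    intro ρ hρ
    have d1 := hasDerivAt_derivUnit h₁ hρ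
    have d2 := hasDerivAt_derivUnit h₂ hρ
    have := (((hasDerivAt_id ρ).neg.div_const 2).mul (d1.norm_sq.add d2.norm_sq)).add
      (d1.inner ℝ d2)
    convert! this using 1
    simp only [hG₁, hG₂, Complex.inner, RCLike.inner_apply', Pi.neg_apply, Pi.add_apply, id,
      ← Complex.normSq_eq_norm_sq, Complex.normSq_apply]
    simp [Complex.mul_re, Complex.mul_im]
    ring
  have hFTC := integral_eq_sub_of_hasDerivAt_unit (w := q)
    (F := fun ρ => (inner ℂ (u₁ ρ) (G₁ ρ) + inner ℂ (u₂ ρ) (G₂ ρ)).re) (by fun_prop)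
    (Complex.continuous_re.comp_continuousOn cH) hq' (right_mem_Icc.2 zero_le_one)
  have hre := integral_re (𝕜 := ℂ) ((memLp_unit_of_continuousOn cH 1).integrable le_rfl)
  rw [hinner]
  simp only [RCLike.re_eq_complex_re] at hre
  rw [← hre, ← integral_Ioc_eq_integral_Ioo, ← intervalIntegral.integral_of_le zero_le_one, hFTC]
  have hn := sq_nonneg ‖u₁ 1 - u₂ 1‖
  rw [norm_sub_sq_real] at hn
  simp only [hq, h0, norm_zero, inner_zero_left]
  linarith

theorem re_inner_le_of_mem_graph {x : StateSpace × StateSpace} (hx : x ∈ freeOp.graph) :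
    (inner ℂ x.1 (x.2 - (1 / 2 : ℂ) • x.1)).re ≤ 0 := by
  rw [freeOp_graph] at hx
  refine closure_minimal (t := {x : StateSpace × StateSpace |
    (inner ℂ x.1 (x.2 - (1 / 2 : ℂ) • x.1)).re ≤ 0})
    (fun y hy => re_inner_nonpos_of_mem_classicalGraph hy) (isClosed_le ?_ continuous_const) hx
  fun_prop

/-- Dissipativity and Cauchy–Schwarz. For Re z > 1/2 this yields injectivity, closed range and the
resolvent bound. -/
theorem mul_norm_le_of_mem_graph {x : StateSpace × StateSpace} (hx : x ∈ freeOp.graph) (z : ℂ) :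
    (z.re - 1 / 2) * ‖x.1‖ ≤ ‖z • x.1 - x.2‖ := by
  rcases eq_or_ne x.1 0 with h | h
  · rw [h, norm_zero, mul_zero]
    exact norm_nonneg _
  · have h1 := re_inner_le_of_mem_graph hx
    have h2 : (inner ℂ x.1 (z • x.1 - x.2)).re = (z.re - 1 / 2) * ‖x.1‖ ^ 2 -
        (inner ℂ x.1 (x.2 - (1 / 2 : ℂ) • x.1)).re := by
      simp only [inner_sub_right, inner_smul_right, inner_self_eq_norm_sq_to_K]
      simp [← Complex.ofReal_pow]
      ring
    have h3 : (inner ℂ x.1 (z • x.1 - x.2)).re ≤ ‖x.1‖ * ‖z • x.1 - x.2‖ :=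
      (Complex.re_le_norm _).trans (norm_inner_le_norm _ _)
    have h4 : 0 < ‖x.1‖ := norm_pos_iff.2 h
    refine le_of_mul_le_mul_left ?_ h4
    nlinarith

/-! ## Surjectivity of `z - L₀` for `Re z > 1/2` -/

/-- By Weierstrass approximation `f` annihilates every continuous function, in particular every test
function on (0,1). -/
theorem eq_zero_of_integral_polynomial_mul_eq_zero {f : L2Unit}
    (hf : ∀ P : Polynomial ℝ, ∫ x, ((P.eval x : ℝ) : ℂ) * f x ∂unitMeasure = 0) : f = 0 := by
  have hi := integrable_unit f
  have hc : ∀ φ : ℝ → ℝ, Continuous φ → ∫ x, (φ x : ℂ) * f x ∂unitMeasure = 0 := by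
    intro φ hφ
    have hint : ∀ ψ : ℝ → ℝ, Continuous ψ →
        Integrable (fun x => (ψ x : ℂ) * f x) unitMeasure := by
      intro ψ hψ
      have : MemLp (fun x => (ψ x : ℂ)) 2 unitMeasure :=
        memLp_unit_of_continuousOn (Complex.continuous_ofReal.comp hψ).continuousOn 2
      exact (Lp.memLp f).integrable_mul this |>.congr (Filter.Eventually.of_forall fun x => by
        simp [mul_comm])
    rw [← norm_le_zero_iff]
    refine le_of_forall_pos_le_add fun ε hε => ?_
    rw [zero_add]
    set N := ∫ x, ‖f x‖ ∂unitMeasure with hN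
    have hN0 : 0 ≤ N := integral_nonneg fun _ => norm_nonneg _
    obtain ⟨P, hP⟩ := exists_polynomial_near_of_continuousOn 0 1 φ hφ.continuousOn (ε / (N + 1))
      (by positivity)
    have h1 : ∫ x, (φ x : ℂ) * f x ∂unitMeasure =
        ∫ x, ((φ x : ℂ) - (P.eval x : ℝ)) * f x ∂unitMeasure := by
      simp_rw [sub_mul]
      rw [integral_sub (hint _ hφ) (hint _ P.continuous), hf P, sub_zero]
    rw [h1]
    calc ‖∫ x, ((φ x : ℂ) - (P.eval x : ℝ)) * f x ∂unitMeasure‖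
        ≤ ∫ x, ε / (N + 1) * ‖f x‖ ∂unitMeasure := by
          refine norm_integral_le_of_norm_le (hi.norm.const_mul _) ?_
          filter_upwards [ae_mem_Ioo] with x hx
          rw [norm_mul]
          gcongr
          rw [← Complex.ofReal_sub, Complex.norm_real, Real.norm_eq_abs, abs_sub_comm]
          exact (hP x (Ioo_subset_Icc_self hx)).le
      _ = ε * (N / (N + 1)) := by rw [integral_const_mul]; ring
      _ ≤ ε * 1 := by
          gcongr
          rw [div_le_one (by positivity)]
          linarith
      _ = ε := mul_one ε
  have := isOpen_Ioo.ae_eq_zero_of_integral_contDiff_smul_eq_zero (μ := volume)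
    (U := Ioo (0 : ℝ) 1) (f := f)
    (IntegrableOn.locallyIntegrableOn hi) (fun g hg _ hs => by
      have h1 := hc g hg.continuous
      rw [← h1, ← integral_indicator measurableSet_Ioo]
      refine integral_congr_ae (Filter.Eventually.of_forall fun x => ?_)
      by_cases hx : x ∈ Ioo (0 : ℝ) 1
      · simp [hx]
      · have : g x = 0 := image_eq_zero_of_notMem_tsupport fun h => hx (hs h)
        simp [this, indicator])
  refine (Lp.eq_zero_iff_ae_eq_zero).2 ?_
  exact (ae_restrict_iff' measurableSet_Ioo).2 this

theorem eq_zero_of_integral_affine_pow_mul_eq_zero {f : L2Unit} {a : ℝ} (ha : a ≠ 0)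
    (hf : ∀ n : ℕ, ∫ x, (1 + (a : ℂ) * x) ^ n * f x ∂unitMeasure = 0) : f = 0 := by
  refine eq_zero_of_integral_polynomial_mul_eq_zero fun P => ?_
  -- Substituting x = (y - 1)/a rewrites P as a polynomial in y = 1 + a x.
  set Q := P.comp (Polynomial.C a⁻¹ * (Polynomial.X - 1)) with hQ
  have hQe : ∀ x : ℝ, ((P.eval x : ℝ) : ℂ) =
      ∑ n ∈ Finset.range (Q.natDegree + 1), (Q.coeff n : ℂ) * (1 + (a : ℂ) * x) ^ n := by
    intro x
    have : P.eval x = Q.eval (1 + a * x) := by simp [hQ, ha]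
    rw [this, Polynomial.eval_eq_sum_range]
    push_cast
    rfl
  simp_rw [hQe, Finset.sum_mul, mul_assoc]
  rw [integral_finsetSum]
  · refine Finset.sum_eq_zero fun n _ => ?_
    rw [integral_const_mul, hf n, mul_zero]
  · intro n _
    refine Integrable.const_mul ?_ _
    have : MemLp (fun x : ℝ => (1 + (a : ℂ) * x) ^ n) 2 unitMeasure :=
      memLp_unit_of_continuousOn (by fun_prop) 2
    exact (Lp.memLp f).integrable_mul this |>.congr (Filter.Eventually.of_forall fun x => by
      simp [mul_comm])

theorem exists_mem_classicalGraph {u₁ u₂ : ℝ → ℂ} (h₁ : ContDiffOn ℝ 1 u₁ (Icc 0 1))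
    (h₂ : ContDiffOn ℝ 1 u₂ (Icc 0 1)) (h0 : u₁ 0 = 0) :
    ∃ x ∈ classicalGraph, x.1.fst =ᵐ[unitMeasure] u₁ ∧ x.1.snd =ᵐ[unitMeasure] u₂ ∧
      x.2.fst =ᵐ[unitMeasure] (fun ρ => -(ρ : ℂ) * derivUnit u₁ ρ + derivUnit u₂ ρ) ∧
      x.2.snd =ᵐ[unitMeasure] (fun ρ => derivUnit u₁ ρ - (ρ : ℂ) * derivUnit u₂ ρ) := by
  have ci : ContinuousOn (fun ρ : ℝ => (ρ : ℂ)) (Icc 0 1) := Complex.continuous_ofReal.continuousOn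
  have c3 := continuousOn_derivUnit h₁
  have c4 := continuousOn_derivUnit h₂
  have m1 := memLp_unit_of_continuousOn h₁.continuousOn 2
  have m2 := memLp_unit_of_continuousOn h₂.continuousOn 2
  have m3 : MemLp (fun ρ : ℝ => -(ρ : ℂ) * derivUnit u₁ ρ + derivUnit u₂ ρ) 2 unitMeasure :=
    memLp_unit_of_continuousOn (by fun_prop) 2
  have m4 : MemLp (fun ρ : ℝ => derivUnit u₁ ρ - (ρ : ℂ) * derivUnit u₂ ρ) 2 unitMeasure :=
    memLp_unit_of_continuousOn (by fun_prop) 2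
  exact ⟨(WithLp.toLp 2 (m1.toLp _, m2.toLp _), WithLp.toLp 2 (m3.toLp _, m4.toLp _)),
    ⟨u₁, u₂, h₁, h₂, h0, m1.coeFn_toLp, m2.coeFn_toLp, m3.coeFn_toLp, m4.coeFn_toLp⟩,
    m1.coeFn_toLp, m2.coeFn_toLp, m3.coeFn_toLp, m4.coeFn_toLp⟩

/-- Smooth characteristic data `w₊ = u₁ + u₂` and `w₋ = u₁ - u₂` with `w₊(0) = -w₋(0)` give an
element of the classical graph. -/
theorem exists_mem_classicalGraph_characteristic {wp wm wp' wm' : ℝ → ℂ}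
    (hp : ContDiffOn ℝ 1 wp (Icc 0 1)) (hm : ContDiffOn ℝ 1 wm (Icc 0 1))
    (hp' : ∀ x ∈ Ioo (0 : ℝ) 1, HasDerivAt wp (wp' x) x)
    (hm' : ∀ x ∈ Ioo (0 : ℝ) 1, HasDerivAt wm (wm' x) x) (h0 : wp 0 + wm 0 = 0) :
    ∃ x ∈ classicalGraph, ∀ z : ℂ,
      (z • x.1 - x.2).fst =ᵐ[unitMeasure] (fun ρ => ((z * wp ρ - (1 - ρ) * wp' ρ) +
        (z * wm ρ + (1 + ρ) * wm' ρ)) / 2) ∧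
      (z • x.1 - x.2).snd =ᵐ[unitMeasure] (fun ρ => ((z * wp ρ - (1 - ρ) * wp' ρ) -
        (z * wm ρ + (1 + ρ) * wm' ρ)) / 2) := by
  obtain ⟨x, hx, e1, e2, e3, e4⟩ := exists_mem_classicalGraph
    (u₁ := fun ρ => (wp ρ + wm ρ) / 2) (u₂ := fun ρ => (wp ρ - wm ρ) / 2)
    ((hp.add hm).div_const 2) ((hp.sub hm).div_const 2) (by simp [h0])
  have d1 : ∀ ρ ∈ Ioo (0 : ℝ) 1,
      derivUnit (fun ρ => (wp ρ + wm ρ) / 2) ρ = (wp' ρ + wm' ρ) / 2 := fun ρ hρ =>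
    (((hp' ρ hρ).add (hm' ρ hρ)).div_const 2).hasDerivWithinAt.derivWithin
      (uniqueDiffOn_Icc zero_lt_one ρ (Ioo_subset_Icc_self hρ))
  have d2 : ∀ ρ ∈ Ioo (0 : ℝ) 1,
      derivUnit (fun ρ => (wp ρ - wm ρ) / 2) ρ = (wp' ρ - wm' ρ) / 2 := fun ρ hρ =>
    (((hp' ρ hρ).sub (hm' ρ hρ)).div_const 2).hasDerivWithinAt.derivWithin
      (uniqueDiffOn_Icc zero_lt_one ρ (Ioo_subset_Icc_self hρ))
  refine ⟨x, hx, fun z => ⟨?_, ?_⟩⟩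
  · change ((z • x.1.fst - x.2.fst : L2Unit) : ℝ → ℂ) =ᵐ[unitMeasure] _
    filter_upwards [Lp.coeFn_sub (z • x.1.fst) x.2.fst, Lp.coeFn_smul z x.1.fst, e1, e3,
      ae_mem_Ioo] with ρ j1 j2 j3 j4 hρ
    rw [j1, Pi.sub_apply, j2, Pi.smul_apply, j3, j4, smul_eq_mul, d1 ρ hρ, d2 ρ hρ]
    ring
  · change ((z • x.1.snd - x.2.snd : L2Unit) : ℝ → ℂ) =ᵐ[unitMeasure] _
    filter_upwards [Lp.coeFn_sub (z • x.1.snd) x.2.snd, Lp.coeFn_smul z x.1.snd, e2, e4,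
      ae_mem_Ioo] with ρ j1 j2 j3 j4 hρ
    rw [j1, Pi.sub_apply, j2, Pi.smul_apply, j3, j4, smul_eq_mul, d1 ρ hρ, d2 ρ hρ]
    ring

/-- The range is closed by the lower bound, so it suffices that its orthogonal complement vanishes.
In the characteristic variables w± = u₁ ± u₂ the operator `z - L₀` decouples into z w₊ - (1 - ρ) w₊'
and z w₋ + (1 + ρ) w₋'. These map (1 ∓ ρ)ⁿ/(z + n) to (1 ∓ ρ)ⁿ, so the range contains enough
polynomials. The boundary condition w₊(0) + w₋(0) = 0 is restored by adding a multiple of (1 +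
ρ)^(-z), which the second expression sends to 0. -/
theorem exists_mem_graph_smul_sub_eq {z : ℂ} (hz : 1 / 2 < z.re) (f : StateSpace) :
    ∃ x ∈ freeOp.graph, z • x.1 - x.2 = f := by
  have hGc : IsClosed (freeOp.graph : Set (StateSpace × StateSpace)) := by
    rw [freeOp_graph]
    exact Submodule.isClosed_topologicalClosure _
  have : CompleteSpace freeOp.graph := hGc.completeSpace_coe
  let A : StateSpace × StateSpace →L[ℂ] StateSpace :=
    z • ContinuousLinearMap.fst ℂ _ _ - ContinuousLinearMap.snd ℂ _ _
  let B : freeOp.graph →L[ℂ] StateSpace := A ∘L freeOp.graph.subtypeL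
  have hB : ∀ x : freeOp.graph, B x = z • (x : StateSpace × StateSpace).1 -
    (x : StateSpace × StateSpace).2 := fun x => rfl
  set δ := z.re - 1 / 2 with hδ
  have hδ0 : 0 < δ := by linarith
  -- The graph carries the maximum norm: the first component costs δ⁻¹, and the second, equal to `z
  -- • x.1 - B x`, costs at most ‖z‖ δ⁻¹ + 1.
  have hanti : AntilipschitzWith (Real.toNNReal (δ⁻¹ + ‖z‖ * δ⁻¹ + 1)) B := by
    refine ContinuousLinearMap.antilipschitz_of_bound B fun x => ?_
    rw [Real.coe_toNNReal _ (by positivity)]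
    have h1 := mul_norm_le_of_mem_graph x.2 z
    rw [← hB] at h1
    have h2 : ‖(x : StateSpace × StateSpace).1‖ ≤ δ⁻¹ * ‖B x‖ := by
      rwa [inv_mul_eq_div, le_div_iff₀ hδ0, mul_comm]
    have h3 : ‖(x : StateSpace × StateSpace).2‖ ≤ ‖z‖ * (δ⁻¹ * ‖B x‖) + ‖B x‖ := by
      have : (x : StateSpace × StateSpace).2 = z • (x : StateSpace × StateSpace).1 - B x := by
        rw [hB]; abel
      rw [this]
      refine (norm_sub_le _ _).trans ?_
      rw [norm_smul]
      gcongr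
    have h4 : 0 ≤ ‖B x‖ := norm_nonneg _
    have h5 : 0 ≤ δ⁻¹ * ‖B x‖ := by positivity
    have h6 : 0 ≤ ‖z‖ * (δ⁻¹ * ‖B x‖) := by positivity
    change ‖(x : StateSpace × StateSpace)‖ ≤ _
    rw [Prod.norm_def]
    exact max_le (by linarith) (by linarith)
  have hclosed : IsClosed (B.range : Set StateSpace) :=
    hanti.isClosed_range B.uniformContinuous
  have hcl : ∀ x ∈ classicalGraph, z • x.1 - x.2 ∈ B.range := fun x hx =>
    ⟨⟨x, by rw [freeOp_graph]; exact classicalGraph.le_topologicalClosure hx⟩, rfl⟩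
  suffices htop : B.range = ⊤ by
    obtain ⟨x, hx⟩ : f ∈ B.range := htop ▸ Submodule.mem_top
    exact ⟨x, x.2, hx⟩
  have : CompleteSpace B.range := hclosed.completeSpace_coe
  rw [← Submodule.orthogonal_eq_bot_iff, Submodule.eq_bot_iff]
  intro y hy
  rw [Submodule.mem_orthogonal'] at hy
  have hzn : ∀ n : ℕ, z + n ≠ 0 := by
    intro n h
    have := congrArg Complex.re h
    simp at this
    have hn : (0 : ℝ) ≤ n := n.cast_nonneg
    linarith
  have hE : ∀ ρ : ℝ, 0 ≤ ρ → HasDerivAt (fun ρ : ℝ => ((1 : ℂ) + ρ) ^ (-z))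
      (-z * (1 + ρ) ^ (-z - 1)) ρ := by
    intro ρ hρ
    have h1 : HasDerivAt (fun w : ℂ => 1 + w) 1 (ρ : ℂ) := (hasDerivAt_id _).const_add 1
    have := (h1.cpow_const (c := -z) (Or.inl (by simp; linarith))).comp_ofReal
    simpa using this
  have hEc : ContDiffOn ℝ 1 (fun ρ : ℝ => ((1 : ℂ) + ρ) ^ (-z)) (Icc 0 1) := by
    intro ρ hρ
    have : ContDiffAt ℂ 1 (fun w : ℂ => (1 + w) ^ (-z)) (ρ : ℂ) :=
      ((analyticAt_const.add analyticAt_id).cpow analyticAt_const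
        (Or.inl (by simp; linarith [hρ.1]))).contDiffAt
    exact ((this.restrict_scalars ℝ).comp ρ
      (Complex.ofRealCLM.contDiff.contDiffAt)).contDiffWithinAt
  have hEe : ∀ ρ ∈ Ioo (0 : ℝ) 1, (1 + (ρ : ℂ)) * (-z * (1 + ρ) ^ (-z - 1)) =
      -z * (1 + ρ) ^ (-z) := by
    intro ρ hρ
    have : (1 + (ρ : ℂ)) ≠ 0 := by
      intro h
      have := congrArg Complex.re h
      simp at this
      linarith [hρ.1]
    rw [Complex.cpow_sub _ _ this, Complex.cpow_one]
    field_simp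
  have hpow : ∀ (a : ℝ) (n : ℕ) (ρ : ℝ),
      HasDerivAt (fun ρ : ℝ => (1 + (a : ℂ) * ρ) ^ n / (z + n))
        (n * (1 + (a : ℂ) * ρ) ^ (n - 1) * a / (z + n)) ρ := by
    intro a n ρ
    have h1 : HasDerivAt (fun ρ : ℝ => (1 : ℂ) + a * ρ) a ρ := by
      simpa using (((hasDerivAt_id ρ).ofReal_comp).const_mul (a : ℂ)).const_add 1
    exact (h1.pow n).div_const _
  have hpowc : ∀ (a : ℝ) (n : ℕ),
      ContDiffOn ℝ 1 (fun ρ : ℝ => (1 + (a : ℂ) * ρ) ^ n / (z + n)) (Icc 0 1) := by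
    intro a n
    exact (((contDiff_const.add (contDiff_const.mul Complex.ofRealCLM.contDiff)).pow
      n).div_const _).contDiffOn
  have hpowe : ∀ (a : ℝ) (n : ℕ) (ρ : ℝ), z * ((1 + (a : ℂ) * ρ) ^ n / (z + n)) +
      (1 + (a : ℂ) * ρ) * (n * (1 + (a : ℂ) * ρ) ^ (n - 1) / (z + n)) =
        (1 + (a : ℂ) * ρ) ^ n := by
    intro a n ρ
    have := hzn n
    cases n with
    | zero => field_simp; simp
    | succ n => field_simp; simp; ring
  have pair : ∀ (x : StateSpace × StateSpace), x ∈ classicalGraph → ∀ F₁ F₂ : ℝ → ℂ,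
      (z • x.1 - x.2).fst =ᵐ[unitMeasure] F₁ → (z • x.1 - x.2).snd =ᵐ[unitMeasure] F₂ →
      ∫ ρ, ((starRingEnd ℂ) (F₁ ρ) * y.fst ρ + (starRingEnd ℂ) (F₂ ρ) * y.snd ρ) ∂unitMeasure
        = 0 := by
    intro x hx F₁ F₂ e1 e2
    have h1 := inner_eq_zero_symm.1 (hy _ (hcl x hx))
    rw [WithLp.prod_inner_apply, L2.inner_def, L2.inner_def,
      ← integral_add (L2.integrable_inner _ _) (L2.integrable_inner _ _)] at h1
    rw [← h1]
    refine integral_congr_ae ?_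
    filter_upwards [e1, e2] with ρ j1 j2
    rw [← j1, ← j2, RCLike.inner_apply', RCLike.inner_apply']
    rfl
  -- Here w₊ = (1 - ρ)ⁿ/(z + n), and w₋ is purely the homogeneous correction. Only the component of
  -- `y` along (1, 1) is then tested.
  have hsum : y.fst + y.snd = 0 := by
    refine eq_zero_of_integral_affine_pow_mul_eq_zero (a := -1) (by norm_num) fun n => ?_
    obtain ⟨x, hx, hxz⟩ := exists_mem_classicalGraph_characteristic (hpowc (-1) n)
      (contDiffOn_const.mul hEc : ContDiffOn ℝ 1 (fun ρ : ℝ => -(1 / (z + n)) *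
        ((1 : ℂ) + ρ) ^ (-z)) _)
      (fun ρ _ => hpow (-1) n ρ) (fun ρ hρ => (hE ρ hρ.1.le).const_mul _) (by simp)
    have := pair x hx _ _ (hxz z).1 (hxz z).2
    have h2 : ∫ ρ, (1 / 2 : ℂ) * ((1 + ((-1 : ℝ) : ℂ) * ρ) ^ n * (y.fst + y.snd : L2Unit) ρ)
        ∂unitMeasure = 0 := by
      rw [← this]
      refine integral_congr_ae ?_
      filter_upwards [Lp.coeFn_add y.fst y.snd, ae_mem_Ioo] with ρ j1 hρ
      have k1 := hpowe (-1) n ρ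
      have k2 := hEe ρ hρ
      have k3 : z * ((1 + ((-1 : ℝ) : ℂ) * ρ) ^ n / (z + n)) - (1 - (ρ : ℂ)) *
          (n * (1 + ((-1 : ℝ) : ℂ) * ρ) ^ (n - 1) * ((-1 : ℝ) : ℂ) / (z + n)) =
          (1 + ((-1 : ℝ) : ℂ) * ρ) ^ n := by
        push_cast at k1 ⊢; linear_combination k1
      have k4 : z * (-(1 / (z + n)) * ((1 : ℂ) + ρ) ^ (-z)) +
          (1 + (ρ : ℂ)) * (-(1 / (z + n)) * (-z * (1 + ρ) ^ (-z - 1))) = 0 := by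
        linear_combination (-(1 / (z + n))) * k2
      have k5 : (starRingEnd ℂ) ((1 + ((-1 : ℝ) : ℂ) * ρ) ^ n) =
        (1 + ((-1 : ℝ) : ℂ) * ρ) ^ n := by simp
      rw [j1, Pi.add_apply, k3, k4, add_zero, sub_zero, map_div₀, k5, map_ofNat]
      ring
    rw [integral_const_mul] at h2
    simpa using h2
  -- Now w₊ = 0, and w₋ is (1 + ρ)ⁿ/(z + n) corrected so as to vanish at 0.
  have hdiff : y.fst - y.snd = 0 := by
    refine eq_zero_of_integral_affine_pow_mul_eq_zero (a := 1) (by norm_num) fun n => ?_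
    obtain ⟨x, hx, hxz⟩ := exists_mem_classicalGraph_characteristic
      (contDiffOn_const : ContDiffOn ℝ 1 (fun _ : ℝ => (0 : ℂ)) _)
      ((hpowc 1 n).add (contDiffOn_const.mul hEc) : ContDiffOn ℝ 1 (fun ρ : ℝ =>
        (1 + ((1 : ℝ) : ℂ) * ρ) ^ n / (z + n) + -(1 / (z + n)) * ((1 : ℂ) + ρ) ^ (-z)) _)
      (fun ρ _ => hasDerivAt_const ρ 0)
      (fun ρ hρ => (hpow 1 n ρ).add ((hE ρ hρ.1.le).const_mul _)) (by simp)
    have := pair x hx _ _ (hxz z).1 (hxz z).2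
    have h2 : ∫ ρ, (1 / 2 : ℂ) * ((1 + ((1 : ℝ) : ℂ) * ρ) ^ n * (y.fst - y.snd : L2Unit) ρ)
        ∂unitMeasure = 0 := by
      rw [← this]
      refine integral_congr_ae ?_
      filter_upwards [Lp.coeFn_sub y.fst y.snd, ae_mem_Ioo] with ρ j1 hρ
      have k1 := hpowe 1 n ρ
      have k2 := hEe ρ hρ
      have k3 : z * ((1 + ((1 : ℝ) : ℂ) * ρ) ^ n / (z + n) +
          -(1 / (z + n)) * ((1 : ℂ) + ρ) ^ (-z)) + (1 + (ρ : ℂ)) *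
          (n * (1 + ((1 : ℝ) : ℂ) * ρ) ^ (n - 1) * ((1 : ℝ) : ℂ) / (z + n) +
            -(1 / (z + n)) * (-z * (1 + ρ) ^ (-z - 1))) =
          (1 + ((1 : ℝ) : ℂ) * ρ) ^ n := by
        rw [Complex.ofReal_one] at k1 ⊢
        linear_combination k1 + (-(1 / (z + n))) * k2
      have k5 : (starRingEnd ℂ) ((1 + ((1 : ℝ) : ℂ) * ρ) ^ n) =
        (1 + ((1 : ℝ) : ℂ) * ρ) ^ n := by simp
      rw [j1, Pi.sub_apply, k3, mul_zero, mul_zero, sub_zero, zero_add, zero_sub, map_div₀,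
        map_div₀, map_neg, k5, map_ofNat]
      ring
    rw [integral_const_mul] at h2
    simpa using h2
  have hs : y.fst = y.snd := sub_eq_zero.1 hdiff
  have h2 : (2 : ℂ) • y.snd = 0 := by rw [two_smul]; nth_rewrite 1 [← hs]; exact hsum
  have h3 : y.snd = 0 := (smul_eq_zero.1 h2).resolve_left two_ne_zero
  exact (WithLp.ofLp_injective 2) (Prod.ext (hs.trans h3) h3)

/-! ### The integral equations characterise the graph of the free operator. -/

theorem eq_zero_of_eq_mulId_mulId {f : L2Unit} (hf : f = mulId (mulId f)) : f = 0 := by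
  refine (Lp.eq_zero_iff_ae_eq_zero).2 ?_
  have h1 := mulId_ae_eq (mulId f)
  rw [← hf] at h1
  filter_upwards [h1, mulId_ae_eq f, ae_mem_Ioo] with ρ j1 j2 hρ
  rw [j2] at j1
  have h2 : (1 - ρ) * (1 + ρ) ≠ 0 := mul_ne_zero (by linarith [hρ.2]) (by linarith [hρ.1])
  have h3 : (((1 - ρ) * (1 + ρ) : ℝ) : ℂ) * f ρ = 0 := by
    push_cast
    linear_combination j1
  simpa using (mul_eq_zero.1 h3).resolve_left (Complex.ofReal_ne_zero.2 h2)

/-- For the converse, surjectivity of `1 - L₀` gives `v` in the graph with v.1 - v.2 = x.1 - x.2.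
The right-hand sides in `IsFreePair` depend on this difference only, which is why z = 1 is used. So
the first components differ by a pair d with d₁ = ρ d₂ and d₂ = ρ d₁, hence d = 0. -/
theorem mem_freeOp_graph_iff {x : StateSpace × StateSpace} : x ∈ freeOp.graph ↔ IsFreePair x := by
  refine ⟨isFreePair_of_mem_graph, fun hx => ?_⟩
  obtain ⟨v, hv, hvx⟩ := exists_mem_graph_smul_sub_eq (z := 1) (by norm_num) (x.1 - x.2)
  rw [one_smul] at hvx
  obtain ⟨a1, a2⟩ := hx
  obtain ⟨b1, b2⟩ := isFreePair_of_mem_graph hv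
  have e1 : x.2.fst - x.1.fst = v.2.fst - v.1.fst := by
    have := congrArg (fun w : StateSpace => -w.fst) hvx
    simp only [WithLp.sub_fst, neg_sub] at this
    exact this.symm
  have e2 : x.2.snd - x.1.snd = v.2.snd - v.1.snd := by
    have := congrArg (fun w : StateSpace => -w.snd) hvx
    simp only [WithLp.sub_snd, neg_sub] at this
    exact this.symm
  rw [e2, ← b1] at a1
  rw [e1, e2, ← b2] at a2
  have c1 : x.1.fst - v.1.fst = mulId (x.1.snd - v.1.snd) := by
    rw [map_sub, sub_eq_sub_iff_add_eq_add]
    rw [sub_eq_sub_iff_add_eq_add] at a1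
    rw [a1, add_comm]
  have c2 : x.1.snd - v.1.snd = mulId (x.1.fst - v.1.fst) := by
    rw [map_sub, sub_eq_sub_iff_add_eq_add]
    rw [sub_eq_sub_iff_add_eq_add] at a2
    rw [a2, add_comm]
  have d2 : x.1.snd - v.1.snd = 0 := eq_zero_of_eq_mulId_mulId (by rw [← c1, ← c2])
  rw [d2, map_zero] at c1
  have h1 : x.1 = v.1 :=
    (WithLp.ofLp_injective 2) (Prod.ext (sub_eq_zero.1 c1) (sub_eq_zero.1 d2))
  have h2 : x = v := Prod.ext h1 (by rw [h1] at hvx; exact (sub_right_injective hvx).symm)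
  rwa [h2]

/-! ### Commuting integration with multiplication by ρ. -/

theorem volterra_mulId_of_continuous {φ : ℝ → ℂ} (hφ : Continuous φ) {f : L2Unit}
    (hf : f =ᵐ[unitMeasure] φ) :
    volterra (mulId f) = mulId (volterra f) - volterra (volterra f) := by
  have hF : ∀ x, HasDerivAt (fun ρ : ℝ => ∫ ξ in (0 : ℝ)..ρ, φ ξ) (φ x) x := fun x =>
    hφ.integral_hasStrictDerivAt 0 x |>.hasDerivAt
  have hFc : Continuous (fun ρ : ℝ => ∫ ξ in (0 : ℝ)..ρ, φ ξ) :=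
    continuous_iff_continuousAt.2 fun x => (hF x).continuousAt
  have hVf : volterra f =ᵐ[unitMeasure] fun ρ => ∫ ξ in (0 : ℝ)..ρ, φ ξ := by
    filter_upwards [volterra_ae_eq f, ae_mem_Ioo] with ρ j1 hρ
    rw [j1, integral_unit_congr hf hρ]
  have hMf : mulId f =ᵐ[unitMeasure] fun ρ => (ρ : ℂ) * φ ρ := by
    filter_upwards [mulId_ae_eq f, hf] with ρ j1 j2
    rw [j1, j2]
  rw [eq_sub_iff_add_eq]
  refine L2Unit_ext (F := fun ρ => (∫ ξ in (0 : ℝ)..ρ, (ξ : ℂ) * φ ξ) +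
    ∫ ξ in (0 : ℝ)..ρ, ∫ s in (0 : ℝ)..ξ, φ s)
    (G := fun ρ => (ρ : ℂ) * ∫ ξ in (0 : ℝ)..ρ, φ ξ) ?_ ?_ ?_
  · filter_upwards [Lp.coeFn_add (volterra (mulId f)) (volterra (volterra f)),
      volterra_ae_eq (mulId f), volterra_ae_eq (volterra f), ae_mem_Ioo] with ρ j1 j2 j3 hρ
    rw [j1, Pi.add_apply, j2, j3, integral_unit_congr hMf hρ, integral_unit_congr hVf hρ]
  · filter_upwards [mulId_ae_eq (volterra f), hVf] with ρ j1 j2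
    rw [j1, j2]
  · intro ρ _
    have hm : Continuous fun ξ : ℝ => (ξ : ℂ) * φ ξ := by fun_prop
    rw [← intervalIntegral.integral_add (hm.intervalIntegrable _ _) (hFc.intervalIntegrable _ _)]
    rw [intervalIntegral.integral_eq_sub_of_hasDerivAt
      (f := fun ρ : ℝ => (ρ : ℂ) * ∫ ξ in (0 : ℝ)..ρ, φ ξ)]
    · simp
    · intro x _
      have h1 : HasDerivAt (fun ρ : ℝ => (ρ : ℂ)) 1 x := (hasDerivAt_id x).ofReal_comp
      convert! h1.mul (hF x) using 1
      ring
    · exact (hm.add hFc).intervalIntegrable _ _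

/-- Integration by parts for continuous `f`, extended by density: the defect is a bounded operator
whose kernel is closed and contains all polynomials. -/
theorem volterra_mulId (f : L2Unit) :
    volterra (mulId f) = mulId (volterra f) - volterra (volterra f) := by
  let A : L2Unit →L[ℂ] L2Unit :=
    volterra ∘L mulId - (mulId ∘L volterra - volterra ∘L volterra)
  have hA : ∀ f, A f = volterra (mulId f) - (mulId (volterra f) - volterra (volterra f)) :=
    fun _ => rfl
  have hker : IsClosed (A.ker : Set L2Unit) := A.isClosed_ker
  have : CompleteSpace A.ker := hker.completeSpace_coe
  have htop : A.ker = ⊤ := by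
    rw [← Submodule.orthogonal_eq_bot_iff, Submodule.eq_bot_iff]
    intro y hy
    refine eq_zero_of_integral_polynomial_mul_eq_zero fun P => ?_
    have hc : Continuous fun x : ℝ => ((P.eval x : ℝ) : ℂ) :=
      Complex.continuous_ofReal.comp P.continuous
    have hm := memLp_unit_of_continuousOn hc.continuousOn 2
    have h1 : hm.toLp _ ∈ A.ker := by
      rw [LinearMap.mem_ker]
      exact sub_eq_zero.2 (volterra_mulId_of_continuous hc hm.coeFn_toLp)
    have h2 := (Submodule.mem_orthogonal _ _).1 hy _ h1
    rw [L2.inner_def] at h2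
    rw [← h2]
    refine integral_congr_ae ?_
    filter_upwards [hm.coeFn_toLp] with x hx
    rw [hx, RCLike.inner_apply']
    simp
  have : f ∈ A.ker := htop ▸ Submodule.mem_top
  exact sub_eq_zero.1 this

/-! ## The eigenvalue equation -/

/-- The perturbed pair `(u, z u - (κ ∫₀^ρ u₂, 0))` lies in the graph of the free operator iff
`u₁` is determined by `u₂`, and `u₂` solves an integrated second order equation. -/
theorem isFreePair_smul_sub_iff {κ z : ℂ} {u : StateSpace} :
    IsFreePair (u, z • u - WithLp.toLp 2 (κ • volterra u.snd, 0)) ↔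
      u.fst = mulId u.snd + (z - 1) • volterra u.snd ∧
      u.snd - mulId (mulId u.snd) =
        (2 * (z - 1)) • mulId (volterra u.snd) +
          ((z - 1) * (z - 2) - κ) • volterra (volterra u.snd) -
        totalInt ((z - 1) • u.fst - κ • volterra u.snd + (z - 1) • u.snd) • constOne := by
  have e1 : ((u, z • u - WithLp.toLp 2 (κ • volterra u.snd, 0)) : StateSpace × StateSpace).2.fst -
      u.fst = (z - 1) • u.fst - κ • volterra u.snd := by
    change z • u.fst - κ • volterra u.snd - u.fst = _
    module
  have e2 : ((u, z • u - WithLp.toLp 2 (κ • volterra u.snd, 0)) : StateSpace × StateSpace).2.snd -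
      u.snd = (z - 1) • u.snd := by
    change z • u.snd - 0 - u.snd = _
    module
  unfold IsFreePair
  rw [e1, e2]
  simp only
  rw [sub_eq_iff_eq_add', map_smul volterra (z - 1)]
  refine and_congr_right fun h1 => ?_
  set t := totalInt ((z - 1) • u.fst - κ • volterra u.snd + (z - 1) • u.snd) with ht
  clear_value t
  rw [h1]
  -- Moving the multiplication outside the integral turns (z - 1)² into (z - 1)² - (z - 1) = (z -
  -- 1)(z - 2) in front of the double integral, and doubles the coefficient of ρ ∫ u₂.
  simp only [map_add, map_sub, map_smul, volterra_mulId]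
  rw [← sub_eq_zero, ← sub_eq_zero (a := u.snd - mulId (mulId u.snd))]
  refine Eq.congr ?_ rfl
  module

/-! ## Binomial series as majorants -/

/-- The Taylor coefficients of `(1 - x)^(-a)`. -/
noncomputable def negBinom {𝕜 : Type*} [RCLike 𝕜] (a : 𝕜) (k : ℕ) : 𝕜 := Ring.multichoose a k

theorem negBinom_zero {𝕜 : Type*} [RCLike 𝕜] (a : 𝕜) : negBinom a 0 = 1 := by
  simp [negBinom]

theorem negBinom_succ {𝕜 : Type*} [RCLike 𝕜] (a : 𝕜) (k : ℕ) :
    negBinom a (k + 1) = negBinom a k * ((k + a) / (k + 1)) := by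
  have h1 := Ring.factorial_nsmul_multichoose_eq_ascPochhammer a (k + 1)
  have h2 := Ring.factorial_nsmul_multichoose_eq_ascPochhammer a k
  rw [Polynomial.ascPochhammer_smeval_eq_eval] at h1 h2
  rw [ascPochhammer_succ_eval, ← h2] at h1
  simp only [nsmul_eq_mul, Nat.factorial_succ, Nat.cast_mul] at h1
  have h3 : (k.factorial : 𝕜) ≠ 0 := Nat.cast_ne_zero.2 k.factorial_ne_zero
  have h4 : (k : 𝕜) + 1 ≠ 0 := Nat.cast_add_one_ne_zero k
  unfold negBinom
  field_simp
  refine mul_left_cancel₀ h3 ?_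
  push_cast at h1
  linear_combination h1

theorem negBinom_pos {a : ℝ} (ha : 0 < a) (k : ℕ) : 0 < negBinom a k := by
  induction k with
  | zero => rw [negBinom_zero]; exact one_pos
  | succ k ih => rw [negBinom_succ]; positivity

theorem choose_add_sub_one {𝕜 : Type*} [RCLike 𝕜] (a : 𝕜) (k : ℕ) :
    Ring.choose (a + k - 1) k = negBinom a k := by
  rw [Ring.choose, negBinom]
  congr 1
  ring

theorem hasSum_negBinom_real (a : ℝ) {x : ℝ} (hx : x ∈ Ico (0 : ℝ) 1) :
    HasSum (fun k => negBinom a k * x ^ k) ((1 - x) ^ (-a)) := by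
  have := (Real.one_div_one_sub_rpow_hasFPowerSeriesOnBall_zero a).hasSum (y := x) (by
    rw [Metric.mem_eball, edist_zero_right, ← ofReal_norm, Real.norm_of_nonneg hx.1]
    simpa using hx.2)
  simp only [FormalMultilinearSeries.ofScalars_apply_eq, choose_add_sub_one, zero_add] at this
  rw [Real.rpow_neg (by linarith [hx.2]), ← one_div]
  simpa [smul_eq_mul] using this

theorem hasSum_negBinom_complex (a : ℂ) {x : ℝ} (hx : x ∈ Ico (0 : ℝ) 1) :
    HasSum (fun k => negBinom a k * (x : ℂ) ^ k) (((1 - x : ℝ) : ℂ) ^ (-a)) := by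
  have := (Complex.one_div_one_sub_cpow_hasFPowerSeriesOnBall_zero a).hasSum (y := (x : ℂ)) (by
    rw [Metric.mem_eball, edist_zero_right, ← ofReal_norm, Complex.norm_real,
      Real.norm_of_nonneg hx.1]
    simpa using hx.2)
  simp only [FormalMultilinearSeries.ofScalars_apply_eq, choose_add_sub_one, zero_add] at this
  rw [Complex.cpow_neg, ← one_div]
  simpa [smul_eq_mul] using this

-- Holds because |k + p| = k + Re p + O(1/k). It allows complex coefficient ratios to be compared
-- with those of a real binomial series, at the cost of an arbitrarily small increase of the
-- exponent.
open Filter in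
theorem eventually_norm_add_le {p : ℂ} {r : ℝ} (h : p.re < r) :
    ∀ᶠ k : ℕ in atTop, ‖(k : ℂ) + p‖ ≤ k + r := by
  have hc := tendsto_natCast_atTop_atTop (R := ℝ)
  filter_upwards [hc.eventually_ge_atTop (-r),
    hc.eventually_ge_atTop (p.im ^ 2 / (r - p.re) - p.re - r)] with k h1 h2
  refine abs_le_of_sq_le_sq' ?_ (by linarith) |>.2
  have h3 : p.im ^ 2 ≤ (r - p.re) * (2 * k + p.re + r) := by
    have h4 : p.im ^ 2 / (r - p.re) ≤ 2 * k + p.re + r := by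
      have : (0 : ℝ) ≤ k := k.cast_nonneg
      linarith
    rwa [div_le_iff₀' (by linarith)] at h4
  rw [← Complex.normSq_eq_norm_sq, Complex.normSq_apply]
  simp
  nlinarith

-- Half of the gap r - Re p bounds |k + p|. The other half, multiplied by k, absorbs the constants q
-- and s.
open Filter in
theorem eventually_norm_quadratic_le {p q : ℂ} {r s : ℝ} (h : p.re < r) :
    ∀ᶠ k : ℕ in atTop, ‖(k : ℂ) ^ 2 + p * k + q‖ ≤ (k : ℝ) ^ 2 + r * k + s := by
  have hc := tendsto_natCast_atTop_atTop (R := ℝ)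
  filter_upwards [eventually_norm_add_le (p := p) (r := (p.re + r) / 2) (by linarith),
    hc.eventually_ge_atTop ((‖q‖ - s) / ((r - p.re) / 2))] with k h1 h2
  rw [div_le_iff₀ (by linarith)] at h2
  have h0 : (0 : ℝ) ≤ k := k.cast_nonneg
  calc ‖(k : ℂ) ^ 2 + p * k + q‖ = ‖(k : ℂ) * (k + p) + q‖ := by ring_nf
    _ ≤ k * ‖(k : ℂ) + p‖ + ‖q‖ := by
      refine (norm_add_le _ _).trans ?_
      rw [norm_mul, Complex.norm_natCast]
    _ ≤ k * (k + (p.re + r) / 2) + ‖q‖ := by gcongr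
    _ ≤ _ := by nlinarith

open Filter in
/-- Coefficients whose ratios are eventually at most those of `(1 - x)^(-a)` are bounded by a
multiple of the latter. -/
theorem exists_le_mul_negBinom {c : ℕ → ℂ} {a : ℝ} (ha : 0 < a)
    (h : ∀ᶠ k : ℕ in atTop, ‖c (k + 1)‖ ≤ ‖c k‖ * ((k + a) / (k + 1))) :
    ∃ M, 0 ≤ M ∧ ∀ k, ‖c k‖ ≤ M * negBinom a k := by
  obtain ⟨N, hN⟩ := eventually_atTop.1 h
  refine ⟨∑ j ∈ Finset.range (N + 1), ‖c j‖ / negBinom a j,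
    Finset.sum_nonneg fun j _ => div_nonneg (norm_nonneg _) (negBinom_pos ha j).le, fun k => ?_⟩
  have hle : ∀ j ≤ N, ‖c j‖ ≤
      (∑ j ∈ Finset.range (N + 1), ‖c j‖ / negBinom a j) * negBinom a j := by
    intro j hj
    rw [← div_le_iff₀ (negBinom_pos ha j)]
    exact Finset.single_le_sum (f := fun j => ‖c j‖ / negBinom a j)
      (fun j _ => div_nonneg (norm_nonneg _) (negBinom_pos ha j).le)
      (Finset.mem_range.2 (by omega))
  rcases le_total k N with hk | hk
  · exact hle k hk
  · induction k, hk using Nat.le_induction with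
    | base => exact hle N le_rfl
    | succ k hk ih =>
      rw [negBinom_succ, ← mul_assoc]
      exact (hN k hk).trans (by gcongr)

/-! ## The odd power series solution -/

/-- The coefficients of the even power series `∑ dₖ ρ^(2k)` solving the second order equation
for `u₂`. -/
noncomputable def eigCoeff (κ z : ℂ) : ℕ → ℂ
  | 0 => 1
  | k + 1 => eigCoeff κ z k *
      (((z + 2 * k) * (z + 2 * k + 1) - κ) / ((2 * k + 1) * (2 * k + 2)))

/-- The even power series solution of the second order equation for `u₂`. -/
noncomputable def eigSeries (κ z : ℂ) (ρ : ℝ) : ℂ := ∑' k, eigCoeff κ z k * (ρ : ℂ) ^ (2 * k)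

-- The coefficient ratio is 1 + (z - 1)/k + O(k⁻²), as for (1 - x)^(-z) with x = ρ². Any positive a
-- > Re z therefore gives a majorant.
open Filter in
theorem exists_norm_eigCoeff_le (κ : ℂ) {z : ℂ} {a : ℝ} (ha : 0 < a) (hz : z.re < a) :
    ∃ M, 0 ≤ M ∧ ∀ k, ‖eigCoeff κ z k‖ ≤ M * negBinom a k := by
  refine exists_le_mul_negBinom ha ?_
  filter_upwards [eventually_norm_quadratic_le (p := z + 1 / 2) (q := (z ^ 2 + z - κ) / 4)
    (r := a + 1 / 2) (s := a / 2) (by simpa using hz)] with k hk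
  rw [eigCoeff, norm_mul]
  gcongr
  have h1 : ((z + 2 * k) * (z + 2 * k + 1) - κ) / ((2 * k + 1) * (2 * k + 2)) =
      ((k : ℂ) ^ 2 + (z + 1 / 2) * k + (z ^ 2 + z - κ) / 4) /
        ((((k : ℝ) + 1 / 2) * (k + 1) : ℝ) : ℂ) := by
    have h2 : (2 * (k : ℂ) + 1) ≠ 0 := by exact_mod_cast Nat.succ_ne_zero (2 * k)
    have h3 : (k : ℂ) + 1 ≠ 0 := Nat.cast_add_one_ne_zero k
    push_cast
    rw [div_eq_div_iff (mul_ne_zero h2 (by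
      rw [show 2 * (k : ℂ) + 2 = 2 * (k + 1) by ring]
      exact mul_ne_zero two_ne_zero h3)) (mul_ne_zero (by
      rw [show (k : ℂ) + 1 / 2 = (2 * k + 1) / 2 by ring]
      exact div_ne_zero h2 two_ne_zero) h3)]
    ring
  rw [h1, norm_div, Complex.norm_real, Real.norm_of_nonneg (by positivity),
    div_le_div_iff₀ (by positivity) (by positivity)]
  calc _ ≤ ((k : ℝ) ^ 2 + (a + 1 / 2) * k + a / 2) * (k + 1) := by gcongr
    _ = _ := by ring

theorem sq_mem_Ico {ρ : ℝ} (hρ : ρ ∈ Ico (0 : ℝ) 1) : ρ ^ 2 ∈ Ico (0 : ℝ) 1 :=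
  ⟨sq_nonneg _, by nlinarith [hρ.1, hρ.2]⟩

theorem summable_norm_eigCoeff (κ z : ℂ) {ρ : ℝ} (hρ : ρ ∈ Ico (0 : ℝ) 1) :
    Summable fun k => ‖eigCoeff κ z k‖ * ρ ^ (2 * k) := by
  obtain ⟨M, hM, h⟩ := exists_norm_eigCoeff_le κ (z := z) (a := |z.re| + 1) (by positivity)
    (by linarith [le_abs_self z.re])
  refine Summable.of_nonneg_of_le (fun k => mul_nonneg (norm_nonneg _) (pow_nonneg hρ.1 _))
    (fun k => ?_) ((hasSum_negBinom_real (|z.re| + 1) (sq_mem_Ico hρ)).summable.mul_left M)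
  rw [pow_mul, ← mul_assoc]
  exact mul_le_mul_of_nonneg_right (h k) (by positivity)

theorem hasSum_eigSeries (κ z : ℂ) {ρ : ℝ} (hρ : ρ ∈ Ico (0 : ℝ) 1) :
    HasSum (fun k => eigCoeff κ z k * (ρ : ℂ) ^ (2 * k)) (eigSeries κ z ρ) := by
  refine Summable.hasSum (Summable.of_norm ?_)
  refine (summable_norm_eigCoeff κ z hρ).congr fun k => ?_
  rw [norm_mul, norm_pow, Complex.norm_real, Real.norm_of_nonneg hρ.1]

theorem exists_norm_eigSeries_le (κ : ℂ) {z : ℂ} {a : ℝ} (ha : 0 < a) (hz : z.re < a) :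
    ∃ M, 0 ≤ M ∧ ∀ ρ ∈ Ico (0 : ℝ) 1, ‖eigSeries κ z ρ‖ ≤ M * (1 - ρ ^ 2) ^ (-a) := by
  obtain ⟨M, hM, h⟩ := exists_norm_eigCoeff_le κ ha hz
  refine ⟨M, hM, fun ρ hρ => ?_⟩
  refine tsum_of_norm_bounded ((hasSum_negBinom_real a (sq_mem_Ico hρ)).mul_left M) fun k => ?_
  rw [norm_mul, norm_pow, Complex.norm_real, Real.norm_of_nonneg hρ.1, pow_mul, ← mul_assoc]
  exact mul_le_mul_of_nonneg_right (h k) (by positivity)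

theorem continuousOn_eigSeries (κ z : ℂ) {r : ℝ} (hr : r ∈ Ico (0 : ℝ) 1) :
    ContinuousOn (eigSeries κ z) (Icc 0 r) := by
  refine continuousOn_tsum (u := fun k => ‖eigCoeff κ z k‖ * r ^ (2 * k)) (fun k => by fun_prop)
    (summable_norm_eigCoeff κ z hr) fun k ρ hρ => ?_
  rw [norm_mul, norm_pow, Complex.norm_real, Real.norm_of_nonneg hρ.1]
  gcongr
  exacts [hρ.1, hρ.2]

/-- Termwise integration of a lacunary power series. -/
theorem hasSum_integral_pow {c : ℕ → ℂ} {e : ℕ → ℕ} {ρ : ℝ} (hρ : 0 ≤ ρ)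
    (hs : Summable fun k => ‖c k‖ * ρ ^ e k) {f : ℝ → ℂ}
    (hf : ∀ ξ ∈ Icc 0 ρ, HasSum (fun k => c k * (ξ : ℂ) ^ e k) (f ξ)) :
    HasSum (fun k => c k / (e k + 1) * (ρ : ℂ) ^ (e k + 1)) (∫ ξ in (0 : ℝ)..ρ, f ξ) := by
  have h1 : HasSum (fun k => ∫ ξ in (0 : ℝ)..ρ, c k * (ξ : ℂ) ^ e k) (∫ ξ in (0 : ℝ)..ρ, f ξ) := by
    refine intervalIntegral.hasSum_integral_of_dominated_convergence
      (fun k _ => ‖c k‖ * ρ ^ e k) (fun k => ?_) (fun k => ?_) ?_ ?_ ?_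
    · exact Continuous.aestronglyMeasurable (by fun_prop)
    · refine Filter.Eventually.of_forall fun ξ hξ => ?_
      rw [uIoc_of_le hρ] at hξ
      rw [norm_mul, norm_pow, Complex.norm_real, Real.norm_of_nonneg hξ.1.le]
      gcongr
      exacts [hξ.1.le, hξ.2]
    · exact Filter.Eventually.of_forall fun _ _ => hs
    · exact intervalIntegrable_const
    · refine Filter.Eventually.of_forall fun ξ hξ => ?_
      rw [uIoc_of_le hρ] at hξ
      exact hf ξ ⟨hξ.1.le, hξ.2⟩
  refine h1.congr_fun fun k => ?_
  rw [intervalIntegral.integral_const_mul]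
  have h2 : ∫ ξ in (0 : ℝ)..ρ, (ξ : ℂ) ^ e k = (((ρ ^ (e k + 1) / (e k + 1) : ℝ)) : ℂ) := by
    simp_rw [← Complex.ofReal_pow]
    rw [intervalIntegral.integral_ofReal, integral_pow]
    simp
  rw [h2]
  push_cast
  ring

/-- The integrated second order equation for the power series. -/
theorem eigSeries_equation (κ z : ℂ) {ρ : ℝ} (hρ : ρ ∈ Ico (0 : ℝ) 1) :
    (1 - (ρ : ℂ) ^ 2) * eigSeries κ z ρ =
      1 + 2 * (z - 1) * (ρ * ∫ ξ in (0 : ℝ)..ρ, eigSeries κ z ξ) +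
        ((z - 1) * (z - 2) - κ) * ∫ ξ in (0 : ℝ)..ρ, ∫ s in (0 : ℝ)..ξ, eigSeries κ z s := by
  have hmem : ∀ {r : ℝ}, r ∈ Ico (0 : ℝ) 1 → ∀ ξ ∈ Icc 0 r, ξ ∈ Ico (0 : ℝ) 1 :=
    fun hr ξ hξ => ⟨hξ.1, hξ.2.trans_lt hr.2⟩
  have h0 := hasSum_eigSeries κ z hρ
  have h1 : ∀ r ∈ Ico (0 : ℝ) 1, HasSum (fun k : ℕ => eigCoeff κ z k / ((2 * k : ℕ) + 1) *
      (r : ℂ) ^ (2 * k + 1)) (∫ ξ in (0 : ℝ)..r, eigSeries κ z ξ) := fun r hr =>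
    hasSum_integral_pow (e := fun k => 2 * k) hr.1 (summable_norm_eigCoeff κ z hr)
      fun ξ hξ => hasSum_eigSeries κ z (hmem hr ξ hξ)
  have h2 : HasSum (fun k : ℕ => eigCoeff κ z k / ((2 * k : ℕ) + 1) / ((2 * k + 1 : ℕ) + 1) *
      (ρ : ℂ) ^ (2 * k + 1 + 1)) (∫ ξ in (0 : ℝ)..ρ, ∫ s in (0 : ℝ)..ξ, eigSeries κ z s) := by
    refine hasSum_integral_pow (c := fun k : ℕ => eigCoeff κ z k / ((2 * k : ℕ) + 1))
      (e := fun k => 2 * k + 1) hρ.1 ?_ fun ξ hξ => h1 ξ (hmem hρ ξ hξ)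
    refine Summable.of_nonneg_of_le (fun k => mul_nonneg (norm_nonneg _) (pow_nonneg hρ.1 _))
      (fun k => ?_) (summable_norm_eigCoeff κ z hρ)
    have h3 : ‖eigCoeff κ z k / ((2 * k : ℕ) + 1)‖ ≤ ‖eigCoeff κ z k‖ := by
      rw [norm_div]
      refine div_le_self (norm_nonneg _) ?_
      rw [← Nat.cast_add_one, Complex.norm_natCast]
      exact_mod_cast Nat.le_add_left 1 (2 * k)
    have h4 : ρ ^ (2 * k + 1) ≤ ρ ^ (2 * k) :=
      pow_le_pow_of_le_one hρ.1 hρ.2.le (Nat.le_succ _)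
    gcongr
    exact pow_nonneg hρ.1 _
  -- Splitting off the term k = 0 produces the constant 1 and aligns all four series at the power
  -- ρ^(2k+2).
  have h3 := (hasSum_nat_add_iff' 1).2 h0
  simp only [Finset.range_one, Finset.sum_singleton, mul_zero, pow_zero, mul_one, eigCoeff] at h3
  have h4 := (((h3.sub (h0.mul_left ((ρ : ℂ) ^ 2))).sub
    ((h1 ρ hρ).mul_left (2 * (z - 1) * ρ))).sub (h2.mul_left ((z - 1) * (z - 2) - κ)))
  have h5 : ∀ k : ℕ, (eigCoeff κ z k *
      (((z + 2 * k) * (z + 2 * k + 1) - κ) / ((2 * k + 1) * (2 * k + 2))) *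
        (ρ : ℂ) ^ (2 * (k + 1)) -
      (ρ : ℂ) ^ 2 * (eigCoeff κ z k * (ρ : ℂ) ^ (2 * k)) -
      2 * (z - 1) * ρ * (eigCoeff κ z k / ((2 * k : ℕ) + 1) * (ρ : ℂ) ^ (2 * k + 1)) -
      ((z - 1) * (z - 2) - κ) * (eigCoeff κ z k / ((2 * k : ℕ) + 1) / ((2 * k + 1 : ℕ) + 1) *
      (ρ : ℂ) ^ (2 * k + 1 + 1))) = 0 := by
    intro k
    have n1 : (2 * (k : ℂ) + 1) ≠ 0 := by exact_mod_cast Nat.succ_ne_zero (2 * k)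
    have n2 : (2 * (k : ℂ) + 1 + 1) ≠ 0 := by exact_mod_cast Nat.succ_ne_zero (2 * k + 1)
    rw [show 2 * (k : ℂ) + 2 = 2 * k + 1 + 1 by ring]
    push_cast
    field_simp
    ring
  simp only [h5] at h4
  have h6 := h4.unique hasSum_zero
  linear_combination h6

/-! ### Eigenfunctions in the half-plane Re z < 1/2. -/

theorem continuousOn_eigSeries_Ico (κ z : ℂ) : ContinuousOn (eigSeries κ z) (Ico 0 1) := by
  intro x hx
  have h := continuousOn_eigSeries κ z (r := (x + 1) / 2)
    ⟨by linarith [hx.1], by linarith [hx.2]⟩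
  refine (h x ⟨hx.1, by linarith [hx.2]⟩).mono_of_mem_nhdsWithin ?_
  filter_upwards [self_mem_nhdsWithin, mem_nhdsWithin_of_mem_nhds
    (Iio_mem_nhds (show x < (x + 1) / 2 by linarith [hx.2]))] with y h1 h2
  exact ⟨h1.1, le_of_lt h2⟩

theorem memLp_eigSeries (κ : ℂ) {z : ℂ} (hz : z.re < 1 / 2) :
    MemLp (eigSeries κ z) 2 unitMeasure := by
  -- The exponent must exceed Re z and 0 for the majorant, and stay below 1/2 so that (1 - ρ)^(-2a)
  -- is integrable.
  obtain ⟨a, ha, ha'⟩ := exists_between (max_lt hz (by norm_num : (0 : ℝ) < 1 / 2))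
  obtain ⟨M, hM, h⟩ := exists_norm_eigSeries_le κ (lt_of_le_of_lt (le_max_right _ _) ha)
    (lt_of_le_of_lt (le_max_left _ _) ha)
  have ha0 : 0 < a := lt_of_le_of_lt (le_max_right _ _) ha
  have hmeas : AEStronglyMeasurable (eigSeries κ z) unitMeasure :=
    ((continuousOn_eigSeries_Ico κ z).mono Ioo_subset_Ico_self).aestronglyMeasurable
      measurableSet_Ioo
  rw [memLp_two_iff_integrable_sq_norm hmeas]
  have hint : Integrable (fun ρ : ℝ => M ^ 2 * (1 - ρ) ^ (-(2 * a))) unitMeasure := by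
    refine Integrable.const_mul ?_ _
    have h1 := (intervalIntegral.intervalIntegrable_rpow' (a := 0) (b := 1) (r := -(2 * a))
      (by linarith)).comp_sub_left 1
    simp only [sub_zero, sub_self] at h1
    have h2 := (intervalIntegrable_iff_integrableOn_Ioo_of_le zero_le_one).1 h1.symm
    exact h2
  refine hint.mono (hmeas.norm.pow 2) ?_
  filter_upwards [ae_mem_Ioo] with ρ hρ
  rw [Real.norm_of_nonneg (by positivity)]
  refine le_trans ?_ (le_abs_self _)
  have h1 : 0 < 1 - ρ := by linarith [hρ.2]
  calc ‖eigSeries κ z ρ‖ ^ 2 ≤ (M * (1 - ρ ^ 2) ^ (-a)) ^ 2 := by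
        gcongr
        exact h ρ ⟨hρ.1.le, hρ.2⟩
    _ ≤ (M * (1 - ρ) ^ (-a)) ^ 2 := by
        have h2 : (1 - ρ ^ 2) ^ (-a) ≤ (1 - ρ) ^ (-a) :=
          Real.rpow_le_rpow_of_nonpos h1 (by nlinarith [hρ.1]) (by linarith)
        have h3 : 0 ≤ (1 - ρ ^ 2) ^ (-a) := Real.rpow_nonneg (by nlinarith [hρ.1]) _
        gcongr
    _ = M ^ 2 * (1 - ρ) ^ (-(2 * a)) := by
        rw [mul_pow, ← Real.rpow_mul_natCast h1.le]
        congr 2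
        push_cast
        ring

open Filter Topology in
theorem tendsto_one_sub_mul_eigSeries (κ : ℂ) {z : ℂ} (hz : z.re < 1 / 2) :
    Tendsto (fun ρ : ℝ => (1 - (ρ : ℂ)) * eigSeries κ z ρ) (𝓝[<] 1) (𝓝 0) := by
  obtain ⟨M, hM, h⟩ := exists_norm_eigSeries_le κ (by norm_num : (0 : ℝ) < 1 / 2) hz
  have hlim : Tendsto (fun ρ : ℝ => M * (1 - ρ) ^ (1 / 2 : ℝ)) (𝓝[<] 1) (𝓝 0) := by
    have hc : Continuous fun ρ : ℝ => M * (1 - ρ) ^ (1 / 2 : ℝ) :=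
      continuous_const.mul ((continuous_const.sub continuous_id).rpow_const fun _ =>
        Or.inr (by norm_num))
    have := (hc.tendsto 1).mono_left (nhdsWithin_le_nhds (s := Iio 1))
    simpa using this
  refine squeeze_zero_norm' ?_ hlim
  filter_upwards [Ioo_mem_nhdsLT (zero_lt_one (α := ℝ))] with ρ hρ
  have h1 : 0 < 1 - ρ := by linarith [hρ.2]
  rw [norm_mul, ← Complex.ofReal_one, ← Complex.ofReal_sub, Complex.norm_real,
    Real.norm_of_nonneg h1.le]
  have h2 : (1 - ρ ^ 2) ^ (-(1 / 2 : ℝ)) ≤ (1 - ρ) ^ (-(1 / 2 : ℝ)) :=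
    Real.rpow_le_rpow_of_nonpos h1 (by nlinarith [hρ.1]) (by norm_num)
  calc (1 - ρ) * ‖eigSeries κ z ρ‖ ≤ (1 - ρ) * (M * (1 - ρ) ^ (-(1 / 2 : ℝ))) := by
        gcongr
        exact (h ρ ⟨hρ.1.le, hρ.2⟩).trans (by gcongr)
    _ = M * ((1 - ρ) ^ (1 : ℝ) * (1 - ρ) ^ (-(1 / 2 : ℝ))) := by rw [Real.rpow_one]; ring
    _ = M * (1 - ρ) ^ (1 / 2 : ℝ) := by
        rw [← Real.rpow_add h1]
        norm_num

theorem integrableOn_Icc_unit (f : L2Unit) : IntegrableOn f (Icc 0 1) volume :=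
  (integrableOn_Icc_iff_integrableOn_Ioo).2 (integrable_unit f)

theorem continuousOn_primitive_unit (f : L2Unit) :
    ContinuousOn (fun ρ : ℝ => ∫ ξ in (0 : ℝ)..ρ, f ξ) (Icc 0 1) := by
  have := intervalIntegral.continuousOn_primitive_interval (a := 0) (b := 1) (f := f)
    (μ := volume) (by rw [uIcc_of_le zero_le_one]; exact integrableOn_Icc_unit f)
  rwa [uIcc_of_le zero_le_one] at this

open Filter Topology in
/-- If the primitive of `f` agrees almost everywhere with a continuous function on `(0,1)`, the
total integral is its limit at `1`. -/
theorem totalInt_eq_of_tendsto {f : L2Unit} {G : ℝ → ℂ} (hG : ContinuousOn G (Ioo 0 1))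
    (hf : volterra f =ᵐ[unitMeasure] G) {l : ℂ} (hl : Tendsto G (𝓝[<] 1) (𝓝 l)) :
    totalInt f = l := by
  have hc := continuousOn_primitive_unit f
  have heq : EqOn (fun ρ : ℝ => ∫ ξ in (0 : ℝ)..ρ, f ξ) G (Ioo 0 1) :=
    Measure.eqOn_open_of_ae_eq (μ := volume) ((volterra_ae_eq f).symm.trans hf) isOpen_Ioo
      (hc.mono Ioo_subset_Icc_self) hG
  have h1 : Tendsto (fun ρ : ℝ => ∫ ξ in (0 : ℝ)..ρ, f ξ) (𝓝[<] 1)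
      (𝓝 (∫ ξ in (0 : ℝ)..1, f ξ)) := by
    refine (hc 1 (right_mem_Icc.2 zero_le_one)).mono_left ?_
    rw [← nhdsWithin_Ioo_eq_nhdsLT (zero_lt_one (α := ℝ))]
    exact nhdsWithin_mono _ Ioo_subset_Icc_self
  have h2 : Tendsto (fun ρ : ℝ => ∫ ξ in (0 : ℝ)..ρ, f ξ) (𝓝[<] 1) (𝓝 l) := by
    refine hl.congr' ?_
    filter_upwards [Ioo_mem_nhdsLT (zero_lt_one (α := ℝ))] with ρ hρ
    exact (heq hρ).symm
  rw [totalInt_apply, integral_unitMeasure]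
  exact tendsto_nhds_unique h1 h2

-- Take u₂ to be the power series and u₁ the function it determines. What remains is the nonlocal
-- constant in the second equation: it has to match the 1 in `eigSeries_equation`. This is where (1
-- - ρ) u₂ → 0 at ρ = 1 enters.
open Filter Topology in
theorem exists_isFreePair_of_re_lt (κ : ℂ) {z : ℂ} (hz : z.re < 1 / 2) :
    ∃ u : StateSpace, u ≠ 0 ∧
      IsFreePair (u, z • u - WithLp.toLp 2 (κ • volterra u.snd, 0)) := by
  have hm := memLp_eigSeries κ hz
  set D := eigSeries κ z with hD
  set f : L2Unit := hm.toLp D with hf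
  have ef : f =ᵐ[unitMeasure] D := hm.coeFn_toLp
  have eM : mulId f =ᵐ[unitMeasure] fun ρ => (ρ : ℂ) * D ρ := by
    filter_upwards [mulId_ae_eq f, ef] with ρ j1 j2
    rw [j1, j2]
  have eMM : mulId (mulId f) =ᵐ[unitMeasure] fun ρ => (ρ : ℂ) * (ρ * D ρ) := by
    filter_upwards [mulId_ae_eq (mulId f), eM] with ρ j1 j2
    rw [j1, j2]
  have eV : volterra f =ᵐ[unitMeasure] fun ρ => ∫ ξ in (0 : ℝ)..ρ, D ξ := by
    filter_upwards [volterra_ae_eq f, ae_mem_Ioo] with ρ j1 hρ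
    rw [j1, integral_unit_congr ef hρ]
  have eMV : mulId (volterra f) =ᵐ[unitMeasure] fun ρ => (ρ : ℂ) * ∫ ξ in (0 : ℝ)..ρ, D ξ := by
    filter_upwards [mulId_ae_eq (volterra f), eV] with ρ j1 j2
    rw [j1, j2]
  have eVV : volterra (volterra f) =ᵐ[unitMeasure]
      fun ρ => ∫ ξ in (0 : ℝ)..ρ, ∫ s in (0 : ℝ)..ξ, D s := by
    filter_upwards [volterra_ae_eq (volterra f), ae_mem_Ioo] with ρ j1 hρ
    rw [j1, integral_unit_congr eV hρ]
  have hsec : f - mulId (mulId f) = (2 * (z - 1)) • mulId (volterra f) +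
      ((z - 1) * (z - 2) - κ) • volterra (volterra f) + constOne := by
    refine L2Unit_ext (F := fun ρ => D ρ - (ρ : ℂ) * (ρ * D ρ))
      (G := fun ρ => 2 * (z - 1) * (ρ * ∫ ξ in (0 : ℝ)..ρ, D ξ) + ((z - 1) * (z - 2) - κ) *
        (∫ ξ in (0 : ℝ)..ρ, ∫ s in (0 : ℝ)..ξ, D s) + 1) ?_ ?_ ?_
    · filter_upwards [Lp.coeFn_sub f (mulId (mulId f)), ef, eMM] with ρ j1 j2 j3
      rw [j1, Pi.sub_apply, j2, j3]
    · filter_upwards [Lp.coeFn_add ((2 * (z - 1)) • mulId (volterra f) +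
          ((z - 1) * (z - 2) - κ) • volterra (volterra f)) constOne,
        Lp.coeFn_add ((2 * (z - 1)) • mulId (volterra f))
          (((z - 1) * (z - 2) - κ) • volterra (volterra f)),
        Lp.coeFn_smul (2 * (z - 1)) (mulId (volterra f)),
        Lp.coeFn_smul ((z - 1) * (z - 2) - κ) (volterra (volterra f)), eMV, eVV, constOne_ae_eq]
        with ρ j1 j2 j3 j4 j5 j6 j7
      rw [j1, Pi.add_apply, j2, Pi.add_apply, j3, Pi.smul_apply, j4, Pi.smul_apply, j5, j6, j7,
        smul_eq_mul, smul_eq_mul]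
    · intro ρ hρ
      have := eigSeries_equation κ z ⟨hρ.1.le, hρ.2⟩
      linear_combination this
  set u : StateSpace := WithLp.toLp 2 (mulId f + (z - 1) • volterra f, f) with hu
  have hu1 : u.fst = mulId f + (z - 1) • volterra f := rfl
  have hu2 : u.snd = f := rfl
  -- By the equation, the primitive of the integrand is (1 - ρ²) u₂ - 1 + (z - 1)(1 - ρ) ∫₀^ρ u₂,
  -- whose limit at ρ = 1 is -1.
  have htot : totalInt ((z - 1) • u.fst - κ • volterra f + (z - 1) • f) = -1 := by
    have hVh : volterra ((z - 1) • u.fst - κ • volterra f + (z - 1) • f) =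
        (f - mulId (mulId f)) - constOne + (z - 1) • (volterra f - mulId (volterra f)) := by
      rw [hsec, hu1]
      simp only [map_add, map_sub, map_smul, volterra_mulId]
      module
    refine totalInt_eq_of_tendsto (G := fun ρ => ((1 + (ρ : ℂ)) * ((1 - ρ) * D ρ) - 1) +
      (z - 1) * ((1 - ρ) * ∫ ξ in (0 : ℝ)..ρ, f ξ)) ?_ ?_ ?_
    · have c1 : ContinuousOn D (Ioo 0 1) :=
        (continuousOn_eigSeries_Ico κ z).mono Ioo_subset_Ico_self
      have c2 := (continuousOn_primitive_unit f).mono Ioo_subset_Icc_self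
      have ci : ContinuousOn (fun ρ : ℝ => (ρ : ℂ)) (Ioo 0 1) :=
        Complex.continuous_ofReal.continuousOn
      fun_prop
    · rw [hVh]
      filter_upwards [Lp.coeFn_add (f - mulId (mulId f) - constOne)
          ((z - 1) • (volterra f - mulId (volterra f))),
        Lp.coeFn_sub (f - mulId (mulId f)) constOne, Lp.coeFn_sub f (mulId (mulId f)),
        Lp.coeFn_smul (z - 1) (volterra f - mulId (volterra f)),
        Lp.coeFn_sub (volterra f) (mulId (volterra f)), ef, eMM, volterra_ae_eq f,
        mulId_ae_eq (volterra f), constOne_ae_eq] with ρ j1 j2 j3 j4 j5 j6 j7 j8 j9 j10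
      rw [j1, Pi.add_apply, j2, Pi.sub_apply, j3, Pi.sub_apply, j4, Pi.smul_apply, j5, Pi.sub_apply,
        j6, j7, j9, j8, j10, smul_eq_mul]
      ring
    · have hid : Tendsto (fun ρ : ℝ => (ρ : ℂ)) (𝓝[<] 1) (𝓝 1) :=
        (Complex.continuous_ofReal.tendsto 1).mono_left nhdsWithin_le_nhds
      have hP : Tendsto (fun ρ : ℝ => ∫ ξ in (0 : ℝ)..ρ, f ξ) (𝓝[<] 1)
          (𝓝 (∫ ξ in (0 : ℝ)..1, f ξ)) := by
        refine (continuousOn_primitive_unit f 1 (right_mem_Icc.2 zero_le_one)).mono_left ?_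
        rw [← nhdsWithin_Ioo_eq_nhdsLT (zero_lt_one (α := ℝ))]
        exact nhdsWithin_mono _ Ioo_subset_Icc_self
      have h1 := tendsto_one_sub_mul_eigSeries κ hz
      have h2 := (((hid.const_add 1).mul h1).sub_const 1).add
        (((hid.const_sub 1).mul hP).const_mul (z - 1))
      simpa using h2
  refine ⟨u, ?_, ?_⟩
  · intro h0
    have hf0 : f = 0 := by rw [← hu2, h0]; rfl
    have h1 : constOne = 0 := by simpa [hf0] using hsec.symm
    have h2 := congrArg totalInt h1
    rw [map_zero, totalInt_apply, integral_congr_ae constOne_ae_eq] at h2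
    simp at h2
  · rw [isFreePair_smul_sub_iff, hu2]
    refine ⟨hu1, ?_⟩
    rw [htot, hsec]
    simp

/-! ## Uniqueness for the second order equation -/

/-- On [0, r] the factor 1 - ρ² is bounded below, so `e` agrees almost everywhere with a continuous
function of its first two primitives E and Y. The pair (E, Y) then solves a linear first order
system with zero initial data, and Grönwall's inequality applies. -/
theorem eq_zero_of_integral_equation {e : ℝ → ℂ} {a c : ℂ} {r : ℝ} (hr : r ∈ Ico (0 : ℝ) 1)
    (hi : IntervalIntegrable e volume 0 r)
    (he : ∀ᵐ ρ : ℝ ∂unitMeasure, (1 - (ρ : ℂ) ^ 2) * e ρ =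
      a * (ρ * ∫ ξ in (0 : ℝ)..ρ, e ξ) + c * ∫ ξ in (0 : ℝ)..ρ, ∫ s in (0 : ℝ)..ξ, e s) :
    ∀ ρ ∈ Icc 0 r, ∫ ξ in (0 : ℝ)..ρ, e ξ = 0 := by
  have hu : uIcc 0 r = Icc 0 r := uIcc_of_le hr.1
  set E : ℝ → ℂ := fun ρ => ∫ ξ in (0 : ℝ)..ρ, e ξ with hE
  set Y : ℝ → ℂ := fun ρ => ∫ ξ in (0 : ℝ)..ρ, E ξ with hY
  have hEc : ContinuousOn E (Icc 0 r) := by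
    have := intervalIntegral.continuousOn_primitive_interval' hi left_mem_uIcc
    rwa [hu] at this
  have hEi : IntervalIntegrable E volume 0 r :=
    ContinuousOn.intervalIntegrable (by rwa [hu])
  have hYc : ContinuousOn Y (Icc 0 r) := by
    have := intervalIntegral.continuousOn_primitive_interval' hEi left_mem_uIcc
    rwa [hu] at this
  have hpos : ∀ x ∈ Icc 0 r, 0 < 1 - x ^ 2 := fun x hx => by nlinarith [hx.1, hx.2, hr.2]
  have hden : ∀ x ∈ Icc 0 r, (1 - (x : ℂ) ^ 2) ≠ 0 := fun x hx => by
    exact_mod_cast (hpos x hx).ne'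
  set v : ℝ → ℂ := fun ρ => (a * (ρ * E ρ) + c * Y ρ) / (1 - (ρ : ℂ) ^ 2) with hv
  have hvc : ContinuousOn v (Icc 0 r) := by
    have ci : ContinuousOn (fun ρ : ℝ => (ρ : ℂ)) (Icc 0 r) :=
      Complex.continuous_ofReal.continuousOn
    exact ContinuousOn.div (by fun_prop) (by fun_prop) hden
  have hev : ∀ x ∈ Icc 0 r, E x = ∫ ξ in (0 : ℝ)..x, v ξ := by
    intro x hx
    refine intervalIntegral.integral_congr_ae ?_
    filter_upwards [(ae_restrict_iff' measurableSet_Ioo).1 he] with ξ hξ hmem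
    rw [uIoc_of_le hx.1] at hmem
    have h1 : ξ ∈ Icc 0 r := ⟨hmem.1.le, hmem.2.trans hx.2⟩
    rw [hv, eq_div_iff (hden ξ h1), mul_comm]
    exact hξ ⟨hmem.1, h1.2.trans_lt hr.2⟩
  have hder : ∀ {g G : ℝ → ℂ}, ContinuousOn g (Icc 0 r) →
      (∀ x ∈ Icc 0 r, G x = ∫ ξ in (0 : ℝ)..x, g ξ) →
      ∀ x ∈ Ico 0 r, HasDerivWithinAt G (g x) (Ici x) x := by
    intro g G hg hG x hx
    have hgi : IntervalIntegrable g volume 0 x :=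
      ContinuousOn.intervalIntegrable (by
        rw [uIcc_of_le hx.1]
        exact hg.mono (Icc_subset_Icc_right hx.2.le))
    have hnhds : Icc 0 r ∈ nhdsWithin x (Ioi x) := by
      filter_upwards [Ioo_mem_nhdsGT hx.2] with y hy
      exact ⟨hx.1.trans hy.1.le, hy.2.le⟩
    have hnhds' : Icc 0 r ∈ nhdsWithin x (Ici x) := by
      filter_upwards [Ico_mem_nhdsGE hx.2] with y hy
      exact ⟨hx.1.trans hy.1, hy.2.le⟩
    have h1 := intervalIntegral.integral_hasDerivWithinAt_right (s := Ici x) (t := Ioi x) hgi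
      ⟨Icc 0 r, hnhds, hg.aestronglyMeasurable measurableSet_Icc⟩
      ((hg x ⟨hx.1, hx.2.le⟩).mono_of_mem_nhdsWithin hnhds)
    refine h1.congr_of_eventuallyEq ?_ (hG x ⟨hx.1, hx.2.le⟩)
    filter_upwards [hnhds'] with y hy
    exact hG y hy
  have hzero := eq_zero_of_abs_deriv_le_mul_abs_self_of_eq_zero_right
    (f := fun x => (E x, Y x)) (f' := fun x => (v x, E x)) (a := 0) (b := r)
    (K := (‖a‖ + ‖c‖) / (1 - r ^ 2) + 1) (hEc.prodMk hYc)
    (fun x hx => (hder hvc hev x hx).prodMk (hder hEc (fun _ _ => rfl) x hx))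
    (by simp [hE, hY]) ?_
  · intro x hx
    exact congrArg Prod.fst (hzero x hx)
  · intro x hx
    have hx' : x ∈ Icc 0 r := ⟨hx.1, hx.2.le⟩
    have hr2 := hpos r ⟨hr.1, le_rfl⟩
    have n1 : ‖E x‖ ≤ ‖(E x, Y x)‖ := norm_fst_le (E x, Y x)
    have n2 : ‖Y x‖ ≤ ‖(E x, Y x)‖ := norm_snd_le (E x, Y x)
    have n0 : 0 ≤ ‖(E x, Y x)‖ := norm_nonneg _
    have hx2 : 1 - r ^ 2 ≤ 1 - x ^ 2 := by nlinarith [hx'.1, hx'.2]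
    have n3 : ‖v x‖ ≤ (‖a‖ + ‖c‖) / (1 - r ^ 2) * ‖(E x, Y x)‖ := by
      have hd : ‖(1 - (x : ℂ) ^ 2)‖ = 1 - x ^ 2 := by
        rw [show (1 - (x : ℂ) ^ 2) = ((1 - x ^ 2 : ℝ) : ℂ) by push_cast; ring, Complex.norm_real,
          Real.norm_of_nonneg (hpos x hx').le]
      rw [hv, norm_div, hd, div_mul_eq_mul_div]
      refine div_le_div₀ (by positivity) ?_ hr2 hx2
      refine (norm_add_le _ _).trans ?_
      rw [norm_mul, norm_mul, norm_mul, Complex.norm_real, Real.norm_of_nonneg hx.1, add_mul]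
      have : x * ‖E x‖ ≤ ‖(E x, Y x)‖ := by
        have := hx'.2.trans hr.2.le
        nlinarith [norm_nonneg (E x)]
      gcongr
    have n4 : 0 ≤ (‖a‖ + ‖c‖) / (1 - r ^ 2) := by positivity
    rw [add_mul, one_mul]
    refine max_le ?_ ?_
    · exact n3.trans (le_add_of_nonneg_right n0)
    · exact n1.trans (le_add_of_nonneg_left (by positivity))

theorem ae_eq_zero_of_integral_equation {e : ℝ → ℂ} {a c : ℂ}
    (hi : ∀ r ∈ Ico (0 : ℝ) 1, IntervalIntegrable e volume 0 r)
    (he : ∀ᵐ ρ : ℝ ∂unitMeasure, (1 - (ρ : ℂ) ^ 2) * e ρ =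
      a * (ρ * ∫ ξ in (0 : ℝ)..ρ, e ξ) + c * ∫ ξ in (0 : ℝ)..ρ, ∫ s in (0 : ℝ)..ξ, e s) :
    e =ᵐ[unitMeasure] 0 := by
  have h0 : ∀ ρ ∈ Ico (0 : ℝ) 1, ∫ ξ in (0 : ℝ)..ρ, e ξ = 0 := fun ρ hρ =>
    eq_zero_of_integral_equation hρ (hi ρ hρ) he ρ ⟨hρ.1, le_rfl⟩
  filter_upwards [he, ae_mem_Ioo] with ρ h1 hρ
  have h2 : ∫ ξ in (0 : ℝ)..ρ, ∫ s in (0 : ℝ)..ξ, e s = ∫ ξ in (0 : ℝ)..ρ, (0 : ℂ) := by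
    refine intervalIntegral.integral_congr fun ξ hξ => ?_
    rw [uIcc_of_le hρ.1.le] at hξ
    exact h0 ξ ⟨hξ.1, hξ.2.trans_lt hρ.2⟩
  rw [h0 ρ ⟨hρ.1.le, hρ.2⟩, h2] at h1
  have h3 : (1 - (ρ : ℂ) ^ 2) ≠ 0 := by
    have : (1 - ρ ^ 2) ≠ 0 := by nlinarith [hρ.1, hρ.2]
    exact_mod_cast this
  simpa [h3] using h1

theorem intervalIntegrable_eigSeries (κ z : ℂ) {r : ℝ} (hr : r ∈ Ico (0 : ℝ) 1) :
    IntervalIntegrable (eigSeries κ z) volume 0 r :=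
  ContinuousOn.intervalIntegrable (by
    rw [uIcc_of_le hr.1]
    exact continuousOn_eigSeries κ z hr)

/-- Every `L²` solution of the integrated second order equation is a multiple of the power series
solution. -/
theorem ae_eq_mul_eigSeries {κ z t : ℂ} {f : L2Unit}
    (hf : f - mulId (mulId f) = (2 * (z - 1)) • mulId (volterra f) +
      ((z - 1) * (z - 2) - κ) • volterra (volterra f) - t • constOne) :
    f =ᵐ[unitMeasure] fun ρ => -t * eigSeries κ z ρ := by
  have hfi : ∀ r ∈ Ico (0 : ℝ) 1, IntervalIntegrable f volume 0 r := fun r hr => by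
    rcases hr.1.eq_or_lt with h | h
    · rw [← h]
    · exact intervalIntegrable_unit f ⟨h, hr.2⟩
  have hDi : ∀ r ∈ Ico (0 : ℝ) 1,
      IntervalIntegrable (fun ρ => t * eigSeries κ z ρ) volume 0 r := fun r hr =>
    (intervalIntegrable_eigSeries κ z hr).const_mul t
  have hprim : ∀ {g : ℝ → ℂ}, (∀ r ∈ Ico (0 : ℝ) 1, IntervalIntegrable g volume 0 r) →
      ∀ r ∈ Ico (0 : ℝ) 1, IntervalIntegrable (fun ρ => ∫ ξ in (0 : ℝ)..ρ, g ξ) volume 0 r :=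
    fun hg r hr => ContinuousOn.intervalIntegrable
      (intervalIntegral.continuousOn_primitive_interval' (hg r hr) left_mem_uIcc)
  have hsum : ∀ r ∈ Ico (0 : ℝ) 1, ∫ ξ in (0 : ℝ)..r, (f ξ + t * eigSeries κ z ξ) =
      (∫ ξ in (0 : ℝ)..r, f ξ) + t * ∫ ξ in (0 : ℝ)..r, eigSeries κ z ξ := fun r hr => by
    rw [intervalIntegral.integral_add (hfi r hr) (hDi r hr), intervalIntegral.integral_const_mul]
  -- The sum f + t · `eigSeries` solves the homogeneous equation, since the constants -t and t
  -- cancel.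
  have hkey : (fun ρ => f ρ + t * eigSeries κ z ρ) =ᵐ[unitMeasure] 0 := by
    refine ae_eq_zero_of_integral_equation (a := 2 * (z - 1)) (c := (z - 1) * (z - 2) - κ)
      (fun r hr => (hfi r hr).add (hDi r hr)) ?_
    have eL := Lp.coeFn_sub f (mulId (mulId f))
    rw [hf] at eL
    filter_upwards [eL, Lp.coeFn_sub ((2 * (z - 1)) • mulId (volterra f) +
          ((z - 1) * (z - 2) - κ) • volterra (volterra f)) (t • constOne),
      Lp.coeFn_add ((2 * (z - 1)) • mulId (volterra f))
        (((z - 1) * (z - 2) - κ) • volterra (volterra f)),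
      Lp.coeFn_smul (2 * (z - 1)) (mulId (volterra f)),
      Lp.coeFn_smul ((z - 1) * (z - 2) - κ) (volterra (volterra f)),
      Lp.coeFn_smul t constOne, constOne_ae_eq, mulId_ae_eq f, mulId_ae_eq (mulId f),
      mulId_ae_eq (volterra f), volterra_ae_eq f, volterra_ae_eq (volterra f), ae_mem_Ioo]
      with ρ j1 j2 j3 j4 j5 j6 j7 j8 j9 j10 j11 j12 hρ
    rw [j2, Pi.sub_apply, j3, Pi.add_apply, j4, Pi.smul_apply, j5, Pi.smul_apply, j6, Pi.smul_apply,
      j7, j10, j11, j12, integral_unit_congr (volterra_ae_eq f) hρ, Pi.sub_apply, j9, j8] at j1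
    simp only [smul_eq_mul] at j1
    have hρ' : ρ ∈ Ico (0 : ℝ) 1 := ⟨hρ.1.le, hρ.2⟩
    have hD := eigSeries_equation κ z hρ'
    have hdouble : ∫ ξ in (0 : ℝ)..ρ, ∫ s in (0 : ℝ)..ξ, (f s + t * eigSeries κ z s) =
        (∫ ξ in (0 : ℝ)..ρ, ∫ s in (0 : ℝ)..ξ, f s) +
          t * ∫ ξ in (0 : ℝ)..ρ, ∫ s in (0 : ℝ)..ξ, eigSeries κ z s := by
      rw [← intervalIntegral.integral_const_mul, ← intervalIntegral.integral_add
        (hprim hfi ρ hρ') ((hprim (fun r hr => intervalIntegrable_eigSeries κ z hr) ρ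
          hρ').const_mul t)]
      refine intervalIntegral.integral_congr fun ξ hξ => ?_
      rw [uIcc_of_le hρ.1.le] at hξ
      exact hsum ξ ⟨hξ.1, hξ.2.trans_lt hρ.2⟩
    rw [hdouble, hsum ρ hρ']
    linear_combination t * hD - j1
  filter_upwards [hkey] with ρ h
  have h' : f ρ + t * eigSeries κ z ρ = 0 := h
  linear_combination h'

/-! ## Behaviour of the power series at the singular point -/

open Filter Topology in
/-- An infinite product with quadratically decaying factors converges, at linear rate, to a
nonzero limit. -/
theorem exists_limit_of_ratio {r ε : ℕ → ℂ} {B : ℝ} (h0 : r 0 = 1)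
    (hr : ∀ k, r (k + 1) = r k * (1 + ε k)) (hne : ∀ k, 1 + ε k ≠ 0)
    (hε : ∀ k : ℕ, ‖ε k‖ ≤ B / ((k : ℝ) + 1) ^ 2) :
    ∃ L : ℂ, L ≠ 0 ∧ ∃ M, 0 ≤ M ∧ ∀ k : ℕ, ‖r k - L‖ ≤ M / (k + 1) := by
  have hsum : Summable fun k => ‖ε k‖ := by
    have h1 : Summable fun k : ℕ => B * (1 / ((k + 1 : ℕ) : ℝ) ^ 2) :=
      (((summable_nat_add_iff 1).2 (Real.summable_one_div_nat_pow.2 one_lt_two))).mul_left B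
    refine Summable.of_nonneg_of_le (fun _ => norm_nonneg _) (fun k => ?_) h1
    refine (hε k).trans (le_of_eq ?_)
    push_cast
    ring
  have hprod : ∀ n, r n = ∏ k ∈ Finset.range n, (1 + ε k) := by
    intro n
    induction n with
    | zero => simpa using h0
    | succ n ih => rw [Finset.prod_range_succ, ← ih, hr]
  have hlim : Tendsto r atTop (𝓝 (∏' k, (1 + ε k))) := by
    have := (multipliable_one_add_of_summable hsum).tendsto_prod_tprod_nat
    exact this.congr fun n => (hprod n).symm
  obtain ⟨R, hR⟩ := (Metric.isBounded_range_of_tendsto r hlim).exists_norm_le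
  have hR' : ∀ k, ‖r k‖ ≤ R := fun k => hR _ (mem_range_self k)
  have hR0 : 0 ≤ R := (norm_nonneg _).trans (hR' 0)
  have hB0 : 0 ≤ B := by simpa using (norm_nonneg _).trans (hε 0)
  refine ⟨_, tprod_one_add_ne_zero_of_summable hne hsum, 2 * R * B, by positivity, fun k => ?_⟩
  -- Telescoping: 1/(n + 1)² ≤ 2 (1/(n + 1) - 1/(n + 2)), and the partial products are bounded by R.
  have hstep : ∀ n, k ≤ n → ‖r n - r k‖ ≤ 2 * R * B * (1 / (k + 1) - 1 / (n + 1)) := by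
    intro n hn
    induction n, hn using Nat.le_induction with
    | base => simp
    | succ n hn ih =>
      have h1 : ‖r (n + 1) - r n‖ ≤ R * (B / ((n : ℝ) + 1) ^ 2) := by
        rw [hr n, mul_add, mul_one, add_sub_cancel_left, norm_mul]
        exact mul_le_mul (hR' n) (hε n) (norm_nonneg _) hR0
      have h2 : R * (B / ((n : ℝ) + 1) ^ 2) ≤
          2 * R * B * (1 / ((n : ℝ) + 1) - 1 / ((n : ℝ) + 1 + 1)) := by
        have hn1 : (0 : ℝ) < (n : ℝ) + 1 := by positivity
        have h3 : 1 / ((n : ℝ) + 1) ^ 2 ≤ 2 * (1 / ((n : ℝ) + 1) - 1 / ((n : ℝ) + 1 + 1)) := by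
          rw [div_sub_div _ _ hn1.ne' (by positivity), ← mul_div_assoc,
            div_le_div_iff₀ (by positivity) (by positivity)]
          have : (0 : ℝ) ≤ n := n.cast_nonneg
          nlinarith
        calc R * (B / ((n : ℝ) + 1) ^ 2) = R * B * (1 / ((n : ℝ) + 1) ^ 2) := by ring
          _ ≤ R * B * (2 * (1 / ((n : ℝ) + 1) - 1 / ((n : ℝ) + 1 + 1))) := by gcongr
          _ = _ := by ring
      calc ‖r (n + 1) - r k‖ ≤ ‖r (n + 1) - r n‖ + ‖r n - r k‖ := by
            rw [← sub_add_sub_cancel (r (n + 1)) (r n) (r k)]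
            exact norm_add_le _ _
        _ ≤ _ := by
          push_cast
          linarith
  have h1 : Tendsto (fun n => ‖r n - r k‖) atTop (𝓝 ‖(∏' k, (1 + ε k)) - r k‖) :=
    (hlim.sub_const _).norm
  rw [norm_sub_rev]
  refine le_of_tendsto h1 (eventually_atTop.2 ⟨k, fun n hn => (hstep n hn).trans ?_⟩)
  rw [mul_sub, mul_one_div]
  have : 0 ≤ 2 * R * B * (1 / ((n : ℝ) + 1)) := by positivity
  linarith

-- The quotients of `eigCoeff` by the coefficients of (1 - x)^(-z) have successive ratios 1 +
-- O(k⁻²), none of them zero as the series does not terminate. They tend to some L ≠ 0 with error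
-- O(1/k), and this extra factor 1/k lowers the exponent of the remainder.
open Filter in
theorem exists_norm_eigSeries_sub_le {κ z : ℂ} (hz : 1 / 2 ≤ z.re)
    (hne : ∀ k : ℕ, (z + 2 * k) * (z + 2 * k + 1) ≠ κ) :
    ∃ L : ℂ, L ≠ 0 ∧ ∃ M, 0 ≤ M ∧ ∀ ρ ∈ Ico (0 : ℝ) 1,
      ‖eigSeries κ z ρ - L * (((1 - ρ ^ 2 : ℝ) : ℂ) ^ (-z))‖ ≤
        M * (1 - ρ ^ 2) ^ (-(z.re - 1 / 4)) := by
  have hkz : ∀ k : ℕ, (k : ℂ) + z ≠ 0 := fun k h => by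
    have h1 := congrArg Complex.re h
    simp at h1
    have h2 : (0 : ℝ) ≤ k := k.cast_nonneg
    linarith
  have hk1 : ∀ k : ℕ, 2 * (k : ℂ) + 1 ≠ 0 := fun k => by exact_mod_cast Nat.succ_ne_zero (2 * k)
  have hk2 : ∀ k : ℕ, (k : ℂ) + 1 ≠ 0 := fun k => Nat.cast_add_one_ne_zero k
  have hh : ∀ k, negBinom z k ≠ 0 := by
    intro k
    induction k with
    | zero => rw [negBinom_zero]; exact one_ne_zero
    | succ k ih =>
      rw [negBinom_succ]
      exact mul_ne_zero ih (div_ne_zero (hkz k) (hk2 k))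
  set ε : ℕ → ℂ := fun k => (z ^ 2 - z - κ) / (2 * (2 * k + 1) * (k + z)) with hε
  have hε1 : ∀ k : ℕ, 1 + ε k = ((z + 2 * k) * (z + 2 * k + 1) - κ) /
      (2 * (2 * k + 1) * (k + z)) := by
    intro k
    have := hkz k
    have := hk1 k
    simp only [hε]
    field_simp
    ring
  obtain ⟨L, hL, M, hM, hLM⟩ := exists_limit_of_ratio
    (r := fun k => eigCoeff κ z k / negBinom z k) (ε := ε) (B := ‖z ^ 2 - z - κ‖)
    (by simp [eigCoeff, negBinom_zero])
    (fun k => by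
      have n1 := hkz k
      have n2 := hk1 k
      have n3 := hk2 k
      have n4 := hh k
      rw [hε1, eigCoeff, negBinom_succ, show 2 * (k : ℂ) + 2 = 2 * (k + 1) by ring]
      field_simp)
    (fun k => by
      rw [hε1]
      exact div_ne_zero (sub_ne_zero.2 (hne k))
        (mul_ne_zero (mul_ne_zero two_ne_zero (hk1 k)) (hkz k)))
    (fun k => by
      have h1 : (k : ℝ) + 1 / 2 ≤ ‖(k : ℂ) + z‖ := by
        refine le_trans ?_ (Complex.re_le_norm _)
        simpa using hz
      have h2 : ‖2 * (2 * (k : ℂ) + 1)‖ = 2 * (2 * (k : ℝ) + 1) := by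
        rw [show 2 * (2 * (k : ℂ) + 1) = ((2 * (2 * (k : ℝ) + 1) : ℝ) : ℂ) by push_cast; ring,
          Complex.norm_real, Real.norm_of_nonneg (by positivity)]
      rw [hε, norm_div, norm_mul, h2]
      have h3 : (0 : ℝ) ≤ k := k.cast_nonneg
      refine div_le_div_of_nonneg_left (norm_nonneg _) (by positivity) ?_
      nlinarith)
  -- Dividing by k + 1 shifts the exponent to Re z - 1, so Re z - 1/4 is a safe majorant. It is
  -- positive because Re z ≥ 1/2.
  obtain ⟨M', hM', hb⟩ := exists_le_mul_negBinom (c := fun k : ℕ => negBinom z k / (k + 1))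
    (a := z.re - 1 / 4) (by linarith) (by
      filter_upwards [eventually_norm_quadratic_le (p := z + 1) (q := z) (r := z.re - 1 / 4 + 2)
        (s := 2 * (z.re - 1 / 4)) (by simp; norm_num; linarith)] with k hk
      have h1 : negBinom z (k + 1) / ((k + 1 : ℕ) + 1) = negBinom z k / (k + 1) *
          (((k : ℂ) ^ 2 + (z + 1) * k + z) / ((((k : ℝ) + 1) * (k + 2) : ℝ) : ℂ)) := by
        have n3 := hk2 k
        have n4 : (k : ℂ) + 2 ≠ 0 := by exact_mod_cast Nat.succ_ne_zero (k + 1)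
        rw [negBinom_succ]
        push_cast
        rw [show (k : ℂ) + 1 + 1 = k + 2 by ring]
        field_simp
        ring
      rw [h1, norm_mul, norm_div, norm_div ((k : ℂ) ^ 2 + (z + 1) * k + z), Complex.norm_real,
        Real.norm_of_nonneg (by positivity)]
      refine mul_le_mul_of_nonneg_left ?_ (by positivity)
      rw [div_le_div_iff₀ (by positivity) (by positivity)]
      calc _ ≤ ((k : ℝ) ^ 2 + (z.re - 1 / 4 + 2) * k + 2 * (z.re - 1 / 4)) * (k + 1) := by gcongr
        _ = _ := by ring)
  refine ⟨L, hL, M * M', by positivity, fun ρ hρ => ?_⟩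
  have hx := sq_mem_Ico hρ
  have hS := (hasSum_eigSeries κ z hρ).sub ((hasSum_negBinom_complex z hx).mul_left L)
  refine hS.norm_le_of_bounded ((hasSum_negBinom_real (z.re - 1 / 4) hx).mul_left (M * M'))
    fun k => ?_
  have h1 : eigCoeff κ z k * (ρ : ℂ) ^ (2 * k) - L * (negBinom z k * ((ρ ^ 2 : ℝ) : ℂ) ^ k) =
      (eigCoeff κ z k / negBinom z k - L) * negBinom z k * ((ρ ^ 2 : ℝ) : ℂ) ^ k := by
    have := hh k
    rw [pow_mul]
    push_cast
    field_simp
  rw [h1, norm_mul, norm_mul, norm_pow, Complex.norm_real, Real.norm_of_nonneg hx.1, ← mul_assoc]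
  refine mul_le_mul_of_nonneg_right ?_ (pow_nonneg hx.1 _)
  have h2 := hb k
  rw [norm_div, ← Nat.cast_add_one, Complex.norm_natCast, Nat.cast_add_one] at h2
  calc ‖eigCoeff κ z k / negBinom z k - L‖ * ‖negBinom z k‖ ≤
        M / (k + 1) * ‖negBinom z k‖ := by
        gcongr
        exact hLM k
    _ = M * (‖negBinom z k‖ / (k + 1)) := by ring
    _ ≤ M * (M' * negBinom (z.re - 1 / 4) k) := by gcongr
    _ = _ := by ring

-- Near 1 the leading term dominates, so |`eigSeries`|² ≥ (|L|²/4) (1 - ρ²)^(-2 Re z), which is at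
-- least a multiple of the non-integrable function 1/(1 - ρ).
open Filter Topology in
theorem not_memLp_eigSeries {κ z : ℂ} (hz : 1 / 2 ≤ z.re)
    (hne : ∀ k : ℕ, (z + 2 * k) * (z + 2 * k + 1) ≠ κ) :
    ¬ MemLp (eigSeries κ z) 2 unitMeasure := by
  intro hmem
  obtain ⟨L, hL, M, hM, hb⟩ := exists_norm_eigSeries_sub_le hz hne
  have hLpos : 0 < ‖L‖ := norm_pos_iff.2 hL
  have hsmall : ∀ᶠ ρ : ℝ in 𝓝[<] 1, M * (1 - ρ ^ 2) ^ (1 / 4 : ℝ) < ‖L‖ / 2 := by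
    have hc : Continuous fun ρ : ℝ => M * (1 - ρ ^ 2) ^ (1 / 4 : ℝ) :=
      continuous_const.mul ((continuous_const.sub (continuous_id.pow 2)).rpow_const fun _ =>
        Or.inr (by norm_num))
    have h1 := (hc.tendsto 1).mono_left (nhdsWithin_le_nhds (s := Iio 1))
    refine h1.eventually_lt_const ?_
    norm_num
    exact hL
  obtain ⟨b, hb0, hb1⟩ := (mem_nhdsLT_iff_exists_Ioo_subset' (zero_lt_one (α := ℝ))).1
    (inter_mem hsmall (Ioo_mem_nhdsLT (zero_lt_one (α := ℝ))))
  have hsq := (memLp_two_iff_integrable_sq_norm hmem.1).1 hmem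
  have hsub : Ioo b 1 ⊆ Ioo 0 1 := fun ρ hρ => (hb1 hρ).2
  -- The factor 8/|L|² combines the square of 2/|L| with the bound 1 - ρ² ≤ 2 (1 - ρ).
  have hsq' : Integrable (fun ρ => 8 / ‖L‖ ^ 2 * ‖eigSeries κ z ρ‖ ^ 2)
      (volume.restrict (Ioo b 1)) :=
    (IntegrableOn.mono_set (t := Ioo 0 1) hsq hsub).const_mul _
  have hinv : IntegrableOn (fun ρ : ℝ => (ρ - 1)⁻¹) (Ioo b 1) volume := by
    refine Integrable.mono' hsq' ?_ ?_
    · exact (measurable_id.sub_const 1).inv.aestronglyMeasurable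
    · filter_upwards [ae_restrict_mem measurableSet_Ioo] with ρ hρ
      obtain ⟨h1, h2⟩ := hb1 hρ
      have h3 : 0 < 1 - ρ := by linarith [h2.2]
      have hy : 0 < 1 - ρ ^ 2 := by nlinarith [h2.1]
      have hy1 : 1 - ρ ^ 2 ≤ 1 := by nlinarith
      have h4 := hb ρ ⟨h2.1.le, h2.2⟩
      set y := 1 - ρ ^ 2 with hydef
      have h5 : ‖L * ((y : ℂ) ^ (-z))‖ = ‖L‖ * y ^ (-z.re) := by
        rw [norm_mul, Complex.norm_cpow_eq_rpow_re_of_pos hy, Complex.neg_re]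
      have h6 : y ^ (-(z.re - 1 / 4)) = y ^ (1 / 4 : ℝ) * y ^ (-z.re) := by
        rw [← Real.rpow_add hy]
        congr 1
        ring
      have h7 : ‖L‖ / 2 * y ^ (-z.re) ≤ ‖eigSeries κ z ρ‖ := by
        have h8 : ‖L * ((y : ℂ) ^ (-z))‖ ≤ ‖eigSeries κ z ρ‖ +
            ‖eigSeries κ z ρ - L * ((y : ℂ) ^ (-z))‖ := by
          have := norm_sub_le (eigSeries κ z ρ) (eigSeries κ z ρ - L * ((y : ℂ) ^ (-z)))
          rwa [sub_sub_cancel] at this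
        rw [h5] at h8
        rw [h6] at h4
        have h9 : 0 < y ^ (-z.re) := Real.rpow_pos_of_pos hy _
        have h10 : M * y ^ (1 / 4 : ℝ) * y ^ (-z.re) ≤ ‖L‖ / 2 * y ^ (-z.re) :=
          mul_le_mul_of_nonneg_right (le_of_lt h1) h9.le
        linarith
      have h8 : y ^ (-(1 / 2) : ℝ) ≤ y ^ (-z.re) :=
        Real.rpow_le_rpow_of_exponent_ge hy hy1 (by linarith)
      have h9 : (y ^ (-(1 / 2) : ℝ)) ^ 2 = y⁻¹ := by
        rw [← Real.rpow_mul_natCast hy.le]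
        norm_num
        rw [Real.rpow_neg_one]
      have h10 : ‖L‖ ^ 2 / 4 * y⁻¹ ≤ ‖eigSeries κ z ρ‖ ^ 2 := by
        rw [← h9]
        calc ‖L‖ ^ 2 / 4 * (y ^ (-(1 / 2) : ℝ)) ^ 2 = (‖L‖ / 2 * y ^ (-(1 / 2) : ℝ)) ^ 2 := by ring
          _ ≤ ‖eigSeries κ z ρ‖ ^ 2 := by
            have h11 : 0 ≤ y ^ (-(1 / 2) : ℝ) := Real.rpow_nonneg hy.le _
            have h12 := (mul_le_mul_of_nonneg_left h8 (half_pos hLpos).le).trans h7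
            gcongr
      have h11 : (1 - ρ)⁻¹ ≤ 2 * y⁻¹ := by
        rw [← div_eq_mul_inv, inv_eq_one_div, div_le_div_iff₀ h3 hy]
        nlinarith
      have h12 : ‖(ρ - 1)⁻¹‖ = (1 - ρ)⁻¹ := by
        rw [norm_inv, norm_sub_rev, Real.norm_of_nonneg h3.le]
      rw [h12]
      calc (1 - ρ)⁻¹ ≤ 2 * y⁻¹ := h11
        _ = 8 / ‖L‖ ^ 2 * (‖L‖ ^ 2 / 4 * y⁻¹) := by
          field_simp
          norm_num
        _ ≤ _ := by gcongr
  have h1 := (intervalIntegrable_iff_integrableOn_Ioo_of_le (le_of_lt hb0)).2 hinv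
  rw [intervalIntegrable_sub_inv_iff] at h1
  rcases h1 with h1 | h1
  · exact hb0.ne h1
  · exact h1 right_mem_uIcc

/-! ## The point spectra -/

/-- u₂ is -t times the power series. If t = 0, then u₂ and with it u₁ vanish. Otherwise the series
itself is in L², which is excluded when Re z ≥ 1/2 and the series does not terminate. -/
theorem re_lt_of_isFreePair {κ z : ℂ} {u : StateSpace} (hu : u ≠ 0)
    (h : IsFreePair (u, z • u - WithLp.toLp 2 (κ • volterra u.snd, 0)))
    (hne : 1 / 2 ≤ z.re → ∀ k : ℕ, (z + 2 * k) * (z + 2 * k + 1) ≠ κ) : z.re < 1 / 2 := by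
  by_contra! hz
  obtain ⟨h1, h2⟩ := isFreePair_smul_sub_iff.1 h
  set t := totalInt ((z - 1) • u.fst - κ • volterra u.snd + (z - 1) • u.snd) with ht
  have h3 := ae_eq_mul_eigSeries h2
  rcases eq_or_ne t 0 with h0 | h0
  · have h4 : u.snd = 0 := by
      refine (Lp.eq_zero_iff_ae_eq_zero).2 (h3.trans (Filter.Eventually.of_forall fun ρ => ?_))
      simp [h0]
    rw [h4, map_zero, map_zero, smul_zero, add_zero] at h1
    exact hu ((WithLp.ofLp_injective 2) (Prod.ext h1 h4))
  · have h4 : MemLp (fun ρ => -t * eigSeries κ z ρ) 2 unitMeasure :=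
      (memLp_congr_ae h3).1 (Lp.memLp u.snd)
    refine not_memLp_eigSeries hz (hne hz) ?_
    refine (memLp_congr_ae (Filter.Eventually.of_forall fun ρ => ?_)).1 (h4.const_mul (-t)⁻¹)
    exact inv_mul_cancel_left₀ (neg_ne_zero.2 h0) _

theorem mem_pointSpectrum_freeOp_iff_exists {z : ℂ} :
    z ∈ pointSpectrum freeOp ↔ ∃ u : StateSpace, u ≠ 0 ∧
      IsFreePair (u, z • u - WithLp.toLp 2 ((0 : ℂ) • volterra u.snd, 0)) := by
  have h0 : ∀ u : StateSpace, z • u - WithLp.toLp 2 ((0 : ℂ) • volterra u.snd, 0) = z • u := by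
    intro u
    rw [zero_smul, ← Prod.zero_eq_mk, WithLp.toLp_zero, sub_zero]
  simp only [h0, ← mem_freeOp_graph_iff, LinearPMap.mem_graph_iff]
  constructor
  · rintro ⟨u, hu, h⟩
    exact ⟨u, fun h' => hu (Subtype.ext h'), u, rfl, h⟩
  · rintro ⟨u, hu, v, hv, h⟩
    exact ⟨v, fun h' => hu (by rw [← hv, h']; rfl), by rw [hv, h]⟩

theorem mem_pointSpectrum_linearizedOp_iff_exists {p : ℕ} {z : ℂ} :
    z ∈ pointSpectrum (linearizedOp p) ↔ ∃ u : StateSpace, u ≠ 0 ∧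
      IsFreePair (u, z • u - WithLp.toLp 2 (((p * c₀ p : ℝ) : ℂ) • volterra u.snd, 0)) := by
  simp only [← perturbation_apply, ← mem_freeOp_graph_iff, LinearPMap.mem_graph_iff]
  have hL : ∀ v : freeOp.domain,
      linearizedOp p v = perturbation p (v : StateSpace) + freeOp v := fun v => rfl
  constructor
  · rintro ⟨u, hu, h⟩
    refine ⟨u, fun h' => hu (Subtype.ext h'), u, rfl, ?_⟩
    exact (eq_sub_of_add_eq' (hL u).symm).trans (congrArg (· - perturbation p (u : StateSpace)) h)
  · rintro ⟨u, hu, v, hv, h⟩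
    refine ⟨v, fun h' => hu (by rw [← hv, h']; rfl), ?_⟩
    rw [hL, h, hv, add_sub_cancel]

/-- For κ = 0 termination would require z = -2k or z = -2k - 1, both with nonpositive real part. -/
theorem pointSpectrum_freeOp : pointSpectrum freeOp = {z | z.re < 1 / 2} := by
  ext z
  rw [mem_pointSpectrum_freeOp_iff_exists]
  refine ⟨?_, fun hz => exists_isFreePair_of_re_lt 0 hz⟩
  rintro ⟨u, hu, h⟩
  refine re_lt_of_isFreePair hu h fun hz k h0 => ?_
  have h3 : (0 : ℝ) ≤ k := k.cast_nonneg
  rcases mul_eq_zero.1 h0 with h1 | h1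
  · have h2 := congrArg Complex.re h1
    simp at h2
    linarith
  · have h2 := congrArg Complex.re h1
    simp at h2
    linarith

/-- `p c₀ = z (z + 1)` for `z = 1 + 2/(p-1)`. -/
theorem mul_c₀_eq {p : ℕ} (hp : 1 < p) :
    ((p * c₀ p : ℝ) : ℂ) = (1 + 2 / ((p : ℂ) - 1)) * (1 + 2 / ((p : ℂ) - 1) + 1) := by
  have h : (p : ℂ) - 1 ≠ 0 := sub_ne_zero.2 (by exact_mod_cast hp.ne')
  unfold c₀
  push_cast
  field_simp
  ring

/-- Here κ = z(z + 1), so the series stops at its constant term. The eigenfunction u = (zρ, 1) is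
smooth and lies in the classical domain. -/
theorem one_add_mem_pointSpectrum_linearizedOp {p : ℕ} (hp : 1 < p) :
    1 + 2 / ((p : ℂ) - 1) ∈ pointSpectrum (linearizedOp p) := by
  rw [mem_pointSpectrum_linearizedOp_iff_exists, mul_c₀_eq hp]
  set z : ℂ := 1 + 2 / ((p : ℂ) - 1) with hz
  have hid : ContDiff ℝ 1 fun ρ : ℝ => (ρ : ℂ) := Complex.ofRealCLM.contDiff
  obtain ⟨x, hx, e1, e2, e3, e4⟩ := exists_mem_classicalGraph
    (u₁ := fun ρ : ℝ => z * ρ) (u₂ := fun _ => 1) (contDiff_const.mul hid).contDiffOn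
    contDiffOn_const (by simp)
  have hd : ∀ ρ ∈ Ioo (0 : ℝ) 1, derivUnit (fun ρ : ℝ => z * ρ) ρ = z := fun ρ hρ => by
    have h1 : HasDerivAt (fun ρ : ℝ => (ρ : ℂ)) 1 ρ := (hasDerivAt_id ρ).ofReal_comp
    have := (h1.const_mul z).hasDerivWithinAt.derivWithin
      (uniqueDiffOn_Icc zero_lt_one ρ (Ioo_subset_Icc_self hρ))
    rwa [mul_one] at this
  have hd' : ∀ ρ : ℝ, derivUnit (fun _ => (1 : ℂ)) ρ = 0 := fun ρ => by simp [derivUnit]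
  have eV : volterra x.1.snd =ᵐ[unitMeasure] fun ρ => (ρ : ℂ) := by
    filter_upwards [volterra_ae_eq x.1.snd, ae_mem_Ioo] with ρ j1 hρ
    rw [j1, integral_unit_congr e2 hρ]
    simp
  refine ⟨x.1, fun h0 => ?_, ?_⟩
  · have h1 : x.1.snd = constOne := Lp.ext (e2.trans constOne_ae_eq.symm)
    have h2 : constOne = 0 := by rw [← h1, h0]; rfl
    have h3 := congrArg totalInt h2
    rw [map_zero, totalInt_apply, integral_congr_ae constOne_ae_eq] at h3
    simp at h3
  · have hx2 : x.2 = z • x.1 - WithLp.toLp 2 ((z * (z + 1)) • volterra x.1.snd, 0) := by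
      refine (WithLp.ofLp_injective 2) (Prod.ext ?_ ?_)
      · change x.2.fst = z • x.1.fst - (z * (z + 1)) • volterra x.1.snd
        refine Lp.ext ?_
        filter_upwards [e1, e3, eV, Lp.coeFn_sub (z • x.1.fst) ((z * (z + 1)) • volterra x.1.snd),
          Lp.coeFn_smul z x.1.fst, Lp.coeFn_smul (z * (z + 1)) (volterra x.1.snd), ae_mem_Ioo]
          with ρ j1 j2 j3 j4 j5 j6 hρ
        rw [j4, Pi.sub_apply, j5, j6, Pi.smul_apply, Pi.smul_apply, j1, j2, j3, hd ρ hρ, hd' ρ,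
          smul_eq_mul, smul_eq_mul]
        ring
      · change x.2.snd = z • x.1.snd - 0
        rw [sub_zero]
        refine Lp.ext ?_
        filter_upwards [e2, e4, Lp.coeFn_smul z x.1.snd, ae_mem_Ioo] with ρ j1 j2 j3 hρ
        rw [j3, Pi.smul_apply, j1, j2, hd ρ hρ, hd' ρ, smul_eq_mul]
        ring
    rw [← hx2]
    exact isFreePair_of_mem_classicalGraph hx

theorem pointSpectrum_linearizedOp {p : ℕ} (hp : 1 < p) (hodd : Odd p) :
    pointSpectrum (linearizedOp p) = pointSpectrum freeOp ∪ {1 + 2 / ((p : ℂ) - 1)} := by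
  rw [pointSpectrum_freeOp]
  refine Subset.antisymm (fun z hz => ?_) (union_subset (fun z hz => ?_) ?_)
  · rw [mem_pointSpectrum_linearizedOp_iff_exists] at hz
    obtain ⟨u, hu, h⟩ := hz
    rw [mem_union, mem_singleton_iff, or_iff_not_imp_right]
    intro hzne
    refine re_lt_of_isFreePair hu h fun hre k hk => ?_
    rw [mul_c₀_eq hp] at hk
    have h3 : (3 : ℝ) ≤ p := by
      obtain ⟨m, rfl⟩ := hodd
      exact_mod_cast (by omega : 3 ≤ 2 * m + 1)
    have hs : 2 / ((p : ℂ) - 1) = ((2 / ((p : ℝ) - 1) : ℝ) : ℂ) := by push_cast; rfl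
    have hs0 : 0 < 2 / ((p : ℝ) - 1) := div_pos two_pos (by linarith)
    have hs1 : 2 / ((p : ℝ) - 1) ≤ 1 := (div_le_one (by linarith)).2 (by linarith)
    rw [hs] at hk hzne
    generalize 2 / ((p : ℝ) - 1) = s at hk hzne hs0 hs1
    have hk0 : (0 : ℝ) ≤ k := k.cast_nonneg
    have hfac : (z + 2 * k - (1 + s)) * (z + 2 * k + (s + 2)) = 0 := by
      linear_combination hk
    rcases mul_eq_zero.1 hfac with h1 | h1
    · rcases Nat.eq_zero_or_pos k with rfl | hkpos
      · refine hzne (sub_eq_zero.1 ?_)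
        simpa using h1
      · have h2 := congrArg Complex.re h1
        simp at h2
        have : (1 : ℝ) ≤ k := by exact_mod_cast hkpos
        linarith
    · have h2 := congrArg Complex.re h1
      simp at h2
      linarith
  · exact mem_pointSpectrum_linearizedOp_iff_exists.2 (exists_isFreePair_of_re_lt _ hz)
  · exact singleton_subset_iff.2 (one_add_mem_pointSpectrum_linearizedOp hp)

/-! ## The spectra -/

theorem mem_opResolventSet_freeOp {z : ℂ} (hz : 1 / 2 < z.re) : z ∈ opResolventSet freeOp := by
  refine mem_opResolventSet_of_surjective (c := z.re - 1 / 2) (by linarith)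
    (fun u => mul_norm_le_of_mem_graph (freeOp.mem_graph u) z) fun f => ?_
  obtain ⟨x, hx, hxf⟩ := exists_mem_graph_smul_sub_eq hz f
  obtain ⟨u, hu1, hu2⟩ := freeOp.mem_graph_iff.1 hx
  exact ⟨u, by rw [hu1, hu2, hxf]⟩

/-- Closedness of the spectrum covers the critical line Re z = a, where nothing is assumed about
eigenvalues. -/
theorem closure_re_lt_subset_opSpectrum {E : Type*} [NormedAddCommGroup E] [NormedSpace ℂ E]
    [CompleteSpace E] {T : E →ₗ.[ℂ] E} {a : ℝ} (h : {z : ℂ | z.re < a} ⊆ pointSpectrum T) :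
    {z : ℂ | z.re ≤ a} ⊆ opSpectrum T := by
  rw [← Complex.closure_setOfPred_re_lt]
  exact closure_minimal (h.trans (pointSpectrum_subset_opSpectrum T))
    (isOpen_opResolventSet T).isClosed_compl

theorem mainTheorem3 (p : ℕ) (hp : 1 < p) (hodd : Odd p) :
    pointSpectrum (linearizedOp p) = pointSpectrum freeOp ∪ {1 + 2 / ((p : ℂ) - 1)} ∧
    opSpectrum freeOp ⊆ opSpectrum (linearizedOp p) ∧
    {z ∈ pointSpectrum (linearizedOp p) | 1 / 2 < z.re} = {1 + 2 / ((p : ℂ) - 1)} := by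
  have hσ := pointSpectrum_linearizedOp hp hodd
  refine ⟨hσ, fun z hz => ?_, ?_⟩
  -- Both spectra are compared with the half-plane Re z ≤ 1/2: it contains σ(L₀) by the resolvent
  -- bound, and it is contained in σ(L).
  · refine closure_re_lt_subset_opSpectrum (a := 1 / 2) ?_ (le_of_not_gt fun h =>
      hz (mem_opResolventSet_freeOp h))
    rw [hσ, pointSpectrum_freeOp]
    exact subset_union_left
  · rw [hσ, pointSpectrum_freeOp]
    ext z
    simp only [mem_ofPred_eq, mem_union, mem_singleton_iff]
    constructor
    · rintro ⟨h1 | h1, h2⟩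
      · exact absurd h1 h2.not_gt
      · exact h1
    · intro h
      refine ⟨Or.inr h, ?_⟩
      have hs : 2 / ((p : ℂ) - 1) = ((2 / ((p : ℝ) - 1) : ℝ) : ℂ) := by push_cast; rfl
      have hs0 : 0 < 2 / ((p : ℝ) - 1) :=
        div_pos two_pos (sub_pos.2 (by exact_mod_cast hp))
      rw [h, hs, Complex.add_re, Complex.ofReal_re, Complex.one_re]
      linarith
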